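/- Let an o-minimal structure on the real field $(\mathbb R,<,+,\cdot)$ be given which is polynomially bounded: for every definable function $f:\mathbb R\to\mathbb R$ there is $N\in\mathbb N$ with $|f(t)|\le t^N$ for all sufficiently large $t$ (definable means definable with real parameters). Let $X,Y\subset\mathbb R^n$ be disjoint definable embedded $C^2$ submanifolds with $\dim Y=\dim X+1$, $X\subset\overline Y$, and such that $X\cup Y$ is locally closed in $\mathbb R^n$. Suppose that $(Y,X)$ is Whitney $(b)$-regular at every point $x_0\in X$, that is, with $\pi$ the nearest point retraction onto $X$ defined near $x_0$, $$\lim_{y\in Y,\;y\to x_0}\ \sup_{v\in T_{\pi(y)}X,\ \|v\|=1} d(v,T_yY)=0\qquad\text{and}\qquad \lim_{y\in Y,\;y\to x_0} d\Big(\tfrac{\pi(y)-y}{\|\pi(y)-y\|},\,T_yY\Big)=0$$ (a supremum over the empty set being $0$). Then: 1. If $x\in X$ is a point such that $Y\cap B(x,\varepsilon)$ is connected for all sufficiently small $\varepsilon>0$, then $x$ has an open neighbourhood $U$ such that $(X\cup Y)\cap U$ is an embedded $C^1$ submanifold with boundary of $\mathbb R^n$, with boundary $X\cap U$. 2. In particular,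 if this holds at every point $x\in X$, then $X\cup Y$ is an embedded $C^1$ submanifold with boundary of $\mathbb R^n$, with boundary $X$. -/

import Mathlib

open Set Filter Topology FirstOrder

noncomputable section

namespace WhitneyPawlucki

/-- The first-order structure `L` on `ℝ` is an o-minimal structure on the real field: it defines
the order, the addition and the multiplication, and every subset of `ℝ` definable with real
parameters is a finite union of intervals (order-connected sets, so points are allowed). -/
structure IsOMinimal (L : Language) [L.Structure ℝ] : Prop where
  definable_lt : (univ : Set ℝ).Definable L {v : Fin 2 → ℝ | v 0 < v 1}
  definable_add : (univ : Set ℝ).Definable L {v : Fin 3 → ℝ | v 0 + v 1 = v 2}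
  definable_mul : (univ : Set ℝ).Definable L {v : Fin 3 → ℝ | v 0 * v 1 = v 2}
  finite_union : ∀ s : Set ℝ, (univ : Set ℝ).Definable₁ L s →
    ∃ F : Set (Set ℝ), F.Finite ∧ (∀ I ∈ F, I.OrdConnected) ∧ s = ⋃₀ F

/-- Every definable function `ℝ → ℝ` is ultimately bounded by a power of the variable. -/
def IsPolynomiallyBounded (L : Language) [L.Structure ℝ] : Prop :=
  ∀ f : ℝ → ℝ, (univ : Set ℝ).Definable L {v : Fin 2 → ℝ | v 1 = f (v 0)} →
    ∃ N : ℕ, ∀ᶠ t in atTop, |f t| ≤ t ^ N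

/-- Definability (with real parameters) of a subset of Euclidean space. -/
def IsDefinable (L : Language) [L.Structure ℝ] {n : ℕ} (S : Set (EuclideanSpace ℝ (Fin n))) :
    Prop :=
  (univ : Set ℝ).Definable L {v : Fin n → ℝ | WithLp.toLp 2 v ∈ S}

/-- The coordinate subspace `ℝ^d × {0}` of `ℝ^n` (used for `d ≤ n`). -/
def flat (n d : ℕ) : Set (EuclideanSpace ℝ (Fin n)) :=
  {z | ∀ i : Fin n, d ≤ (i : ℕ) → z i = 0}

/-- The closed half-space `ℝ^d × [0, ∞) × {0}` of `ℝ^(d+1) × {0} ⊆ ℝ^n` (used for `d + 1 ≤ n`);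
its boundary is `flat n d`. -/
def halfFlat (n d : ℕ) : Set (EuclideanSpace ℝ (Fin n)) :=
  {z | z ∈ flat n (d + 1) ∧ ∀ i : Fin n, (i : ℕ) = d → 0 ≤ z i}

/-- `Φ` is a diffeomorphism of class `C^k` between open subsets of `ℝ^n`. -/
def IsDiffeo (k : WithTop ℕ∞) {n : ℕ}
    (Φ : OpenPartialHomeomorph (EuclideanSpace ℝ (Fin n)) (EuclideanSpace ℝ (Fin n))) : Prop :=
  ContDiffOn ℝ k Φ Φ.source ∧ ContDiffOn ℝ k Φ.symm Φ.target

/-- `M` is a (not necessarily closed) embedded `C^k` submanifold of `ℝ^n`, of dimension `d` at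
each of its points: locally a diffeomorphism of the ambient space straightens it. -/
def IsSubmanifold (k : WithTop ℕ∞) {n : ℕ} (d : ℕ) (M : Set (EuclideanSpace ℝ (Fin n))) : Prop :=
  d ≤ n ∧ ∀ p ∈ M, ∃ Φ : OpenPartialHomeomorph (EuclideanSpace ℝ (Fin n))
      (EuclideanSpace ℝ (Fin n)),
    p ∈ Φ.source ∧ IsDiffeo k Φ ∧ ∀ x ∈ Φ.source, (x ∈ M ↔ Φ x ∈ flat n d)

/-- `M` is an embedded `C^k` submanifold with boundary of `ℝ^n`, of dimension `d + 1`, whose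
boundary is exactly `B`. -/
def IsSubmanifoldWithBoundary (k : WithTop ℕ∞) {n : ℕ} (d : ℕ)
    (M B : Set (EuclideanSpace ℝ (Fin n))) : Prop :=
  d + 1 ≤ n ∧ B ⊆ M ∧
  (∀ p ∈ M \ B, ∃ Φ : OpenPartialHomeomorph (EuclideanSpace ℝ (Fin n))
      (EuclideanSpace ℝ (Fin n)),
    p ∈ Φ.source ∧ IsDiffeo k Φ ∧
      ∀ x ∈ Φ.source, (x ∈ M ↔ Φ x ∈ flat n (d + 1)) ∧ x ∉ B) ∧
  (∀ p ∈ B, ∃ Φ : OpenPartialHomeomorph (EuclideanSpace ℝ (Fin n)) (EuclideanSpace ℝ (Fin n)),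
    p ∈ Φ.source ∧ IsDiffeo k Φ ∧
      ∀ x ∈ Φ.source, (x ∈ M ↔ Φ x ∈ halfFlat n d) ∧ (x ∈ B ↔ Φ x ∈ flat n d))

/-- The tangent space `T_p M`. (At a point of a `C^1` submanifold the tangent cone is already a
linear subspace.) -/
def tangentSpace {n : ℕ} (M : Set (EuclideanSpace ℝ (Fin n))) (p : EuclideanSpace ℝ (Fin n)) :
    Submodule ℝ (EuclideanSpace ℝ (Fin n)) :=
  Submodule.span ℝ (tangentConeAt ℝ M p)

/-- `δ(A, B)`, the supremum of the distances to `B` of the unit vectors of `A`; it is `0` if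
`A = 0`. -/
def subspaceDist {n : ℕ} (A B : Submodule ℝ (EuclideanSpace ℝ (Fin n))) : ℝ :=
  sSup ((fun v => Metric.infDist v (B : Set (EuclideanSpace ℝ (Fin n)))) '' {v | v ∈ A ∧ ‖v‖ = 1})

/-- The distance from `T_{π(y)} X` to `T_y Y`. -/
def alpha {n : ℕ} (X Y : Set (EuclideanSpace ℝ (Fin n)))
    (π : EuclideanSpace ℝ (Fin n) → EuclideanSpace ℝ (Fin n)) (y : EuclideanSpace ℝ (Fin n)) : ℝ :=
  subspaceDist (tangentSpace X (π y)) (tangentSpace Y y)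

/-- The distance from the unit vector along `π(y) - y` to `T_y Y`. -/
def beta {n : ℕ} (Y : Set (EuclideanSpace ℝ (Fin n)))
    (π : EuclideanSpace ℝ (Fin n) → EuclideanSpace ℝ (Fin n)) (y : EuclideanSpace ℝ (Fin n)) : ℝ :=
  Metric.infDist (‖π y - y‖⁻¹ • (π y - y)) (tangentSpace Y y : Set (EuclideanSpace ℝ (Fin n)))

/-- Near `x`, the map `π` is the nearest point retraction onto `X`. (Near a point of a `C^2`
submanifold the nearest point exists and is unique, so the germ of `π` at `x` is determined.) -/
def IsNearestPointRetraction {n : ℕ} (X : Set (EuclideanSpace ℝ (Fin n)))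
    (x : EuclideanSpace ℝ (Fin n)) (π : EuclideanSpace ℝ (Fin n) → EuclideanSpace ℝ (Fin n)) :
    Prop :=
  ∀ᶠ y in 𝓝 x, π y ∈ X ∧ ∀ q ∈ X, dist y (π y) ≤ dist y q

/-- Whitney's condition `(b)` for the pair `(Y, X)` at the point `x` of `X`. -/
def WhitneyBAt {n : ℕ} (Y X : Set (EuclideanSpace ℝ (Fin n))) (x : EuclideanSpace ℝ (Fin n)) :
    Prop :=
  ∃ π : EuclideanSpace ℝ (Fin n) → EuclideanSpace ℝ (Fin n),
    IsNearestPointRetraction X x π ∧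
    Tendsto (alpha X Y π) (𝓝[Y] x) (𝓝 0) ∧ Tendsto (beta Y π) (𝓝[Y] x) (𝓝 0)

/-- `Y ∩ B(x, ε)` is connected for all sufficiently small `ε > 0`. -/
def ConnectedNear {n : ℕ} (Y : Set (EuclideanSpace ℝ (Fin n))) (x : EuclideanSpace ℝ (Fin n)) :
    Prop :=
  ∀ᶠ ε in 𝓝[>] (0 : ℝ), IsConnected (Y ∩ Metric.ball x ε)

end WhitneyPawlucki

end

noncomputable section
namespace WhitneyPawlucki

/-! ### Definability and the power bound from polynomial boundedness -/

section Definability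

variable {L : Language} [L.Structure ℝ] {α : Type*}

/-! Near a point of `X`, write `X` as the graph of a `C^1` section `g` of a linear projection `P`
onto a tangent space, and give a point `y` of `Y` the coordinates `footHeight`: its base point `P y`
and its distance to `g (P y)`. The `frame` at `y`, made of the derivative of `g` and the unit vector
`direction` from `g (P y)` to `y`, is an exact right inverse of the derivative of `footHeight`.
Condition (b) says that `T_yY` almost contains the range of the frame
(`IsGraphOn.eventually_frame_approx`). Since `T_yY` has the dimension of the coordinate space,
`footHeight` restricted to `Y` is a local diffeomorphism close to `X`.

Local closedness makes this local diffeomorphism proper over a ball times an interval `(0, δ)`,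
hence a covering of a contractible base. Connectedness of `Y` in small balls leaves one sheet near
`x`, so `Y` is there the image of a `C^1` section `s` whose derivative is asymptotic to the frame
(`IsGraphOn.exists_section`).

It remains to extend `s` in a `C^1` way to height `0`, that is, to show that the direction converges
as `t → 0`, uniformly in the base point. Its `t`-derivative is `o(1/t)`, so its oscillation over a
dyadic interval is `o(1)`; this alone need not be summable, and the direction might keep turning.
Polynomial boundedness closes the gap: the heights at which an oscillation of size `σ` occurs are
bounded below by a power of `σ`, so the oscillation at height `t` is at most a positive power of `t`
(`IsGraphOn.direction_oscillation_le_pow`). Summing a geometric series gives a uniform, hence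
continuous, limit `u` (`exists_uniform_limit`).

Finally `s` is reflected oddly in the graph of `g`. The result is `C^1` across height `0`
(`contDiffOn_oddExtension`) with injective derivative there, and the inverse function theorem turns
it into a boundary chart. -/

lemma IsOMinimal.definableFun_add (hL : IsOMinimal L) {f g : (α → ℝ) → ℝ}
    (hf : (univ : Set ℝ).DefinableFun L f) (hg : (univ : Set ℝ).DefinableFun L g) :
    (univ : Set ℝ).DefinableFun L (fun v => f v + g v) := by
  have key : (univ : Set ℝ).DefinableFun L (fun v : Fin 2 → ℝ => v 0 + v 1) := by
    have h := hL.definable_add.preimage_comp (fun i : Fin 3 => (![some 0, some 1, none] :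
      Fin 3 → Option (Fin 2)) i)
    simpa [Set.DefinableFun, Function.tupleGraph] using! h
  have hm : (univ : Set ℝ).DefinableMap L (fun v : α → ℝ => (![f v, g v] : Fin 2 → ℝ)) := by
    intro i; fin_cases i <;> simpa
  exact key.comp hm

lemma IsOMinimal.definableFun_mul (hL : IsOMinimal L) {f g : (α → ℝ) → ℝ}
    (hf : (univ : Set ℝ).DefinableFun L f) (hg : (univ : Set ℝ).DefinableFun L g) :
    (univ : Set ℝ).DefinableFun L (fun v => f v * g v) := by
  have key : (univ : Set ℝ).DefinableFun L (fun v : Fin 2 → ℝ => v 0 * v 1) := by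
    have h := hL.definable_mul.preimage_comp (fun i : Fin 3 => (![some 0, some 1, none] :
      Fin 3 → Option (Fin 2)) i)
    simpa [Set.DefinableFun, Function.tupleGraph] using! h
  have hm : (univ : Set ℝ).DefinableMap L (fun v : α → ℝ => (![f v, g v] : Fin 2 → ℝ)) := by
    intro i; fin_cases i <;> simpa
  exact key.comp hm

lemma definableFun_real_const (c : ℝ) :
    (univ : Set ℝ).DefinableFun L (fun _ : α → ℝ => c) :=
  L.definableFun_const α (mem_univ c)

lemma IsOMinimal.definableFun_sub (hL : IsOMinimal L) {f g : (α → ℝ) → ℝ}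
    (hf : (univ : Set ℝ).DefinableFun L f) (hg : (univ : Set ℝ).DefinableFun L g) :
    (univ : Set ℝ).DefinableFun L (fun v => f v - g v) := by
  have := hL.definableFun_add hf (hL.definableFun_mul (definableFun_real_const (-1)) hg)
  simpa [sub_eq_add_neg] using this

lemma IsOMinimal.definableFun_sum (hL : IsOMinimal L) {ι : Type*} (s : Finset ι)
    {f : ι → (α → ℝ) → ℝ} (hf : ∀ i, (univ : Set ℝ).DefinableFun L (f i)) :
    (univ : Set ℝ).DefinableFun L (fun v => ∑ i ∈ s, f i v) := by
  classical
  induction s using Finset.induction_on with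
  | empty => simpa using definableFun_real_const 0
  | insert i s hi ih => simpa [Finset.sum_insert hi] using hL.definableFun_add (hf i) ih

lemma IsOMinimal.definable_setOf_lt (hL : IsOMinimal L) {f g : (α → ℝ) → ℝ}
    (hf : (univ : Set ℝ).DefinableFun L f) (hg : (univ : Set ℝ).DefinableFun L g) :
    (univ : Set ℝ).Definable L {v | f v < g v} := by
  have hm : (univ : Set ℝ).DefinableMap L (fun v : α → ℝ => (![f v, g v] : Fin 2 → ℝ)) := by
    intro i; fin_cases i <;> simpa
  exact hL.definable_lt.preimage_map hm

lemma IsOMinimal.definable_setOf_le (hL : IsOMinimal L) {f g : (α → ℝ) → ℝ}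
    (hf : (univ : Set ℝ).DefinableFun L f) (hg : (univ : Set ℝ).DefinableFun L g) :
    (univ : Set ℝ).Definable L {v | f v ≤ g v} := by
  have h := (hL.definable_setOf_lt hg hf).compl
  have e : {v | f v ≤ g v} = {v | g v < f v}ᶜ := by ext v; simp
  rw [e]; exact h

lemma IsOMinimal.definableFun_norm_sq (hL : IsOMinimal L) {n : ℕ}
    {f : (α → ℝ) → EuclideanSpace ℝ (Fin n)}
    (hf : ∀ i, (univ : Set ℝ).DefinableFun L (fun v => f v i)) :
    (univ : Set ℝ).DefinableFun L (fun v => ‖f v‖ ^ 2) := by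
  have := hL.definableFun_sum Finset.univ (fun i => hL.definableFun_mul (hf i) (hf i))
  simp only [EuclideanSpace.real_norm_sq_eq]
  simpa only [sq] using this

lemma IsOMinimal.definableFun_linear (hL : IsOMinimal L) {n : ℕ}
    (φ : EuclideanSpace ℝ (Fin n) →L[ℝ] ℝ) {f : (α → ℝ) → EuclideanSpace ℝ (Fin n)}
    (hf : ∀ i, (univ : Set ℝ).DefinableFun L (fun v => f v i)) :
    (univ : Set ℝ).DefinableFun L (fun v => φ (f v)) := by
  have := hL.definableFun_sum Finset.univ (fun i => hL.definableFun_mul (hf i)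
    (definableFun_real_const (φ (EuclideanSpace.single i 1))))
  convert this using 2 with v
  conv_lhs => rw [← (EuclideanSpace.basisFun (Fin n) ℝ).sum_repr (f v), map_sum]
  simp

lemma IsDefinable.preimage {n : ℕ} {S : Set (EuclideanSpace ℝ (Fin n))} (hS : IsDefinable L S)
    {f : (α → ℝ) → EuclideanSpace ℝ (Fin n)}
    (hf : ∀ i, (univ : Set ℝ).DefinableFun L (fun v => f v i)) :
    (univ : Set ℝ).Definable L {v | f v ∈ S} :=
  hS.preimage_map (F := fun v i => f v i) hf

/-- If a definable relation `R σ t` forces, for each `σ > 0`, a positive lower bound on `t`, then in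
a polynomially bounded structure this lower bound is a power of `σ`. -/
lemma IsPolynomiallyBounded.exists_pow_le (hL : IsOMinimal L) (hpb : IsPolynomiallyBounded L)
    {R : ℝ → ℝ → Prop} (hR : (univ : Set ℝ).Definable L {v : Fin 2 → ℝ | R (v 0) (v 1)})
    (hinf : ∀ σ > 0, ∃ t₀ > 0, ∀ t, R σ t → t₀ ≤ t) :
    ∃ N : ℕ, ∃ σ₀ > 0, ∀ σ t, 0 < σ → σ < σ₀ → R σ t → σ ^ N ≤ t := by
  -- For `x > 0` the set collects the inverses `1/t` with `R (1/x) t`, so its supremum is the best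
  -- lower bound for `t` seen at infinity. Inverses are expressed by polynomial equations to stay
  -- definable; `0` is added so that the supremum is over a nonempty set.
  set T : ℝ → Set ℝ := fun x => {z | z = 0 ∨ (0 < x ∧ ∃ w : Fin 2 → ℝ,
    (w 0 * x = 1 ∧ z * w 1 = 1 ∧ R (w 0) (w 1)))} with hT
  have hTdef : (univ : Set ℝ).Definable L {v : Fin 2 → ℝ | v 1 ∈ T (v 0)} := by
    have h1 : (univ : Set ℝ).Definable L {v : Fin 2 → ℝ | v 1 = 0} :=
      DefinableFun.ofPred_eq (DefinableFun.proj L) (definableFun_real_const 0)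
    have h2 : (univ : Set ℝ).Definable L {v : Fin 2 → ℝ | 0 < v 0} :=
      hL.definable_setOf_lt (definableFun_real_const 0) (DefinableFun.proj L)
    have h3 : (univ : Set ℝ).Definable L {v : Fin 2 → ℝ | ∃ w : Fin 2 → ℝ, Sum.elim v w ∈
        ({v | v (Sum.inr 0) * v (Sum.inl 0) = 1} ∩ ({v | v (Sum.inl 1) * v (Sum.inr 1) = 1} ∩
          {v | R (v (Sum.inr 0)) (v (Sum.inr 1))}) : Set (Fin 2 ⊕ Fin 2 → ℝ))} := by
      refine Definable.exists_of_finite (Definable.inter ?_ (Definable.inter ?_ ?_))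
      · exact DefinableFun.ofPred_eq (hL.definableFun_mul (DefinableFun.proj L)
          (DefinableFun.proj L)) (definableFun_real_const 1)
      · exact DefinableFun.ofPred_eq (hL.definableFun_mul (DefinableFun.proj L)
          (DefinableFun.proj L)) (definableFun_real_const 1)
      · exact hR.preimage_comp (Sum.inr : Fin 2 → Fin 2 ⊕ Fin 2)
    exact h1.union (h2.inter h3)
  have hbdd : ∀ x, BddAbove (T x) := by
    intro x
    rcases le_or_gt x 0 with hx | hx
    · refine ⟨0, ?_⟩
      rintro z (rfl | ⟨h, -⟩)
      · exact le_rfl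
      · exact absurd h (not_lt.2 hx)
    · obtain ⟨t₀, ht₀, h⟩ := hinf x⁻¹ (inv_pos.2 hx)
      refine ⟨t₀⁻¹, ?_⟩
      rintro z (rfl | ⟨-, w, h1, h2, h3⟩)
      · exact (inv_pos.2 ht₀).le
      · rw [eq_inv_of_mul_eq_one_left h1] at h3
        rw [eq_inv_of_mul_eq_one_left h2]
        exact inv_anti₀ ht₀ (h _ h3)
  set f : ℝ → ℝ := fun x => sSup (T x) with hf
  have hlub : ∀ x, IsLUB (T x) (f x) := fun x => isLUB_csSup ⟨0, Or.inl rfl⟩ (hbdd x)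
  have hupper : (univ : Set ℝ).Definable L {v : Fin 2 → ℝ | ∀ u : Fin 1 → ℝ, Sum.elim v u ∈
      ({v | v (Sum.inr 0) ∈ T (v (Sum.inl 0))} ⇨ {v | v (Sum.inr 0) ≤ v (Sum.inl 1)} :
        Set (Fin 2 ⊕ Fin 1 → ℝ))} := by
    refine Definable.forall_of_finite (Definable.himp ?_ ?_)
    · exact hTdef.preimage_comp (![Sum.inl 0, Sum.inr 0] : Fin 2 → Fin 2 ⊕ Fin 1)
    · exact hL.definable_setOf_le (DefinableFun.proj L) (DefinableFun.proj L)
  have hupper' : (univ : Set ℝ).Definable L {v : Fin 2 → ℝ | v 1 ∈ upperBounds (T (v 0))} := by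
    convert hupper using 1
    ext v
    simp only [mem_upperBounds, himp_eq, mem_ofPred_eq]
    constructor
    · intro h u
      by_cases hu : u 0 ∈ T (v 0)
      · exact Or.inl (h _ hu)
      · exact Or.inr hu
    · intro h z hz
      rcases h ![z] with h | h
      · exact h
      · exact absurd hz h
  have hleast : (univ : Set ℝ).Definable L {v : Fin 2 → ℝ | ∀ u : Fin 1 → ℝ, Sum.elim v u ∈
      ({v | v (Sum.inr 0) ∈ upperBounds (T (v (Sum.inl 0)))} ⇨
        {v | v (Sum.inl 1) ≤ v (Sum.inr 0)} : Set (Fin 2 ⊕ Fin 1 → ℝ))} := by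
    refine Definable.forall_of_finite (Definable.himp ?_ ?_)
    · exact hupper'.preimage_comp (![Sum.inl 0, Sum.inr 0] : Fin 2 → Fin 2 ⊕ Fin 1)
    · exact hL.definable_setOf_le (DefinableFun.proj L) (DefinableFun.proj L)
  -- Being the least upper bound of a definable family is a first-order condition.
  have hfdef : (univ : Set ℝ).Definable L {v : Fin 2 → ℝ | v 1 = f (v 0)} := by
    convert hupper'.inter hleast using 1
    ext v
    simp only [himp_eq, mem_ofPred_eq, mem_inter_iff]
    constructor
    · intro h
      rw [h]
      refine ⟨(hlub _).1, fun u => ?_⟩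
      by_cases hu : u 0 ∈ upperBounds (T (v 0))
      · left
        change v 1 ≤ u 0
        rw [h]
        exact (hlub _).2 hu
      · exact Or.inr hu
    · rintro ⟨h1, h2⟩
      refine IsLUB.unique ⟨h1, fun z hz => ?_⟩ (hlub (v 0))
      rcases h2 ![z] with h | h
      · exact h
      · exact absurd hz h
  obtain ⟨N, hN⟩ := hpb f hfdef
  obtain ⟨M, hM⟩ := eventually_atTop.1 hN
  -- Below this threshold `σ⁻¹` exceeds `M`, where the polynomial bound on `f` is valid; the maximum
  -- with `1` only keeps the threshold positive.
  refine ⟨N, (max M 1)⁻¹, by positivity, fun σ t hσ hσM hRt => ?_⟩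
  obtain ⟨t₀, ht₀, h0⟩ := hinf σ hσ
  have ht : 0 < t := ht₀.trans_le (h0 t hRt)
  have h1 : t⁻¹ ≤ f σ⁻¹ := (hlub σ⁻¹).1 (Or.inr ⟨inv_pos.2 hσ, ![σ, t],
    by simp [hσ.ne'], by simp [ht.ne'], by simpa using hRt⟩)
  have h2 : M ≤ σ⁻¹ := by
    have := (lt_inv_comm₀ hσ (by positivity)).1 hσM
    exact (le_max_left _ _).trans this.le
  have h3 := (h1.trans (le_abs_self _)).trans (hM _ h2)
  rw [inv_pow] at h3
  exact (inv_le_inv₀ ht (by positivity)).1 h3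

/-- Two points of `Y` over the same point of `X` near `x₀`, at comparable distances `t`, `t'` from
it, whose directions differ by at least `σ`. -/
def DirectionOscillation {n : ℕ} {F : Type*} [NormedAddCommGroup F] [NormedSpace ℝ F]
    (X Y : Set (EuclideanSpace ℝ (Fin n)))
    (P : EuclideanSpace ℝ (Fin n) →L[ℝ] F) (x₀ : EuclideanSpace ℝ (Fin n)) (η δ σ t : ℝ) : Prop :=
  0 < σ ∧ 0 < t ∧ t < δ ∧ ∃ (p u u' : EuclideanSpace ℝ (Fin n)) (t' : ℝ),
    p ∈ X ∧ ‖p - x₀‖ ^ 2 < η ^ 2 ∧ ‖u‖ ^ 2 = 1 ∧ ‖u'‖ ^ 2 = 1 ∧ P u = 0 ∧ P u' = 0 ∧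
    p + t • u ∈ Y ∧ p + t' • u' ∈ Y ∧ t ≤ 2 * t' ∧ t' ≤ t ∧ σ * σ ≤ ‖u - u'‖ ^ 2

/-- Norms enter the relation only through their squares, which makes each condition polynomial in
the coordinates or a membership in `X` or `Y`; what remains is a projection along finitely many real
variables. -/
lemma definable_directionOscillation (hL : IsOMinimal L) {n d : ℕ}
    {X Y : Set (EuclideanSpace ℝ (Fin n))} (hX : IsDefinable L X) (hY : IsDefinable L Y)
    (P : EuclideanSpace ℝ (Fin n) →L[ℝ] (Fin d → ℝ)) (x₀ : EuclideanSpace ℝ (Fin n)) (η δ : ℝ) :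
    (univ : Set ℝ).Definable L
      {v : Fin 2 → ℝ | DirectionOscillation X Y P x₀ η δ (v 0) (v 1)} := by
  let I := Fin 2 ⊕ ((Fin n ⊕ Fin n) ⊕ (Fin n ⊕ Fin 1))
  let p : (I → ℝ) → EuclideanSpace ℝ (Fin n) := fun v =>
    WithLp.toLp 2 fun i => v (Sum.inr (Sum.inl (Sum.inl i)))
  let u : (I → ℝ) → EuclideanSpace ℝ (Fin n) := fun v =>
    WithLp.toLp 2 fun i => v (Sum.inr (Sum.inl (Sum.inr i)))
  let u' : (I → ℝ) → EuclideanSpace ℝ (Fin n) := fun v =>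
    WithLp.toLp 2 fun i => v (Sum.inr (Sum.inr (Sum.inl i)))
  let t' : (I → ℝ) → ℝ := fun v => v (Sum.inr (Sum.inr (Sum.inr 0)))
  let σ : (I → ℝ) → ℝ := fun v => v (Sum.inl 0)
  let t : (I → ℝ) → ℝ := fun v => v (Sum.inl 1)
  have hp : ∀ i, (univ : Set ℝ).DefinableFun L (fun v => p v i) := fun i => DefinableFun.proj L
  have hu : ∀ i, (univ : Set ℝ).DefinableFun L (fun v => u v i) := fun i => DefinableFun.proj L
  have hu' : ∀ i, (univ : Set ℝ).DefinableFun L (fun v => u' v i) := fun i => DefinableFun.proj L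
  have ht' : (univ : Set ℝ).DefinableFun L t' := DefinableFun.proj L
  have ht : (univ : Set ℝ).DefinableFun L t := DefinableFun.proj L
  have hσ : (univ : Set ℝ).DefinableFun L σ := DefinableFun.proj L
  have hker : ∀ w : (I → ℝ) → EuclideanSpace ℝ (Fin n),
      (∀ i, (univ : Set ℝ).DefinableFun L (fun v => w v i)) →
      (univ : Set ℝ).Definable L {v | P (w v) = 0} := by
    intro w hw
    have e : {v | P (w v) = 0} = ⋂ j, {v | (ContinuousLinearMap.proj j ∘L P) (w v) = 0} := by
      ext v; simp [funext_iff]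
    rw [e]
    exact definable_iInter_of_finite fun j => DefinableFun.ofPred_eq
      (hL.definableFun_linear _ hw) (definableFun_real_const 0)
  have h := Definable.exists_of_finite (α := Fin 2) <| Definable.inter
    (hX.preimage hp) <| Definable.inter
    (hL.definable_setOf_lt (hL.definableFun_norm_sq (f := fun v => p v - x₀)
      fun i => hL.definableFun_sub (hp i) (definableFun_real_const (x₀ i)))
      (definableFun_real_const (η ^ 2))) <| Definable.inter
    (DefinableFun.ofPred_eq (hL.definableFun_norm_sq hu) (definableFun_real_const 1)) <|
    Definable.inter
    (DefinableFun.ofPred_eq (hL.definableFun_norm_sq hu') (definableFun_real_const 1)) <|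
    Definable.inter (hker u hu) <| Definable.inter (hker u' hu') <| Definable.inter
    (hY.preimage (f := fun v => p v + t v • u v)
      fun i => hL.definableFun_add (hp i) (hL.definableFun_mul ht (hu i))) <| Definable.inter
    (hY.preimage (f := fun v => p v + t' v • u' v)
      fun i => hL.definableFun_add (hp i) (hL.definableFun_mul ht' (hu' i))) <| Definable.inter
    (hL.definable_setOf_le ht (hL.definableFun_mul (definableFun_real_const 2) ht')) <|
    Definable.inter (hL.definable_setOf_le ht' ht) <|
    (hL.definable_setOf_le (hL.definableFun_mul hσ hσ)
      (hL.definableFun_norm_sq (f := fun v => u v - u' v)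
        fun i => hL.definableFun_sub (hu i) (hu' i)))
  have h1 : (univ : Set ℝ).Definable L {v : Fin 2 → ℝ | 0 < v 0} :=
    hL.definable_setOf_lt (definableFun_real_const 0) (DefinableFun.proj L)
  have h2 : (univ : Set ℝ).Definable L {v : Fin 2 → ℝ | 0 < v 1} :=
    hL.definable_setOf_lt (definableFun_real_const 0) (DefinableFun.proj L)
  have h3 : (univ : Set ℝ).Definable L {v : Fin 2 → ℝ | v 1 < δ} :=
    hL.definable_setOf_lt (DefinableFun.proj L) (definableFun_real_const δ)
  convert h1.inter (h2.inter (h3.inter h)) using 1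
  ext v
  simp only [DirectionOscillation, mem_ofPred_eq, mem_inter_iff]
  refine and_congr Iff.rfl (and_congr Iff.rfl (and_congr Iff.rfl ?_))
  constructor
  · rintro ⟨p, u, u', t', h⟩
    exact ⟨Sum.elim (Sum.elim p u) (Sum.elim u' (fun _ => t')), h⟩
  · rintro ⟨w, h⟩
    exact ⟨_, _, _, _, h⟩

end Definability

/-! ### Tangent spaces, local equations and local sections of submanifolds -/

section Submanifold

variable {n : ℕ} {F : Type*} [NormedAddCommGroup F] [NormedSpace ℝ F]

lemma fderiv_mem_tangentSpace {M : Set (EuclideanSpace ℝ (Fin n))}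
    {γ : F → EuclideanSpace ℝ (Fin n)} {γ' : F →L[ℝ] EuclideanSpace ℝ (Fin n)} {z : F}
    (h : HasFDerivAt γ γ' z) (hM : ∀ᶠ w in 𝓝 z, γ w ∈ M) (v : F) :
    γ' v ∈ tangentSpace M (γ z) := by
  have h1 := (h.hasFDerivWithinAt (s := {w | γ w ∈ M})).mapsTo_tangent_cone
  have h2 : tangentConeAt ℝ {w | γ w ∈ M} z = univ := tangentConeAt_of_mem_nhds hM
  have h3 : v ∈ tangentConeAt ℝ {w | γ w ∈ M} z := by rw [h2]; trivial
  refine Submodule.subset_span (tangentConeAt_mono ?_ (h1 h3))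
  rintro _ ⟨w, hw, rfl⟩
  exact hw

/-- A derivative carries tangent cones to tangent cones, and the image lies in `{0}`, which has no
accumulation point and so only the zero tangent vector. -/
lemma tangentSpace_le_ker {M U : Set (EuclideanSpace ℝ (Fin n))} {p : EuclideanSpace ℝ (Fin n)}
    {q : EuclideanSpace ℝ (Fin n) → F} {q' : EuclideanSpace ℝ (Fin n) →L[ℝ] F}
    (hq : HasFDerivAt q q' p) (hU : U ∈ 𝓝 p) (h0 : ∀ x ∈ M ∩ U, q x = 0) :
    tangentSpace M p ≤ q'.ker := by
  refine Submodule.span_le.2 fun w hw => ?_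
  rw [← tangentConeAt_inter_nhds hU] at hw
  have h1 := (hq.hasFDerivWithinAt (s := M ∩ U)).mapsTo_tangent_cone hw
  have h2 : tangentConeAt ℝ (q '' (M ∩ U)) (q p) ⊆ {0} := by
    refine tangentConeAt_subset_zero fun hacc => ?_
    have hs : q '' (M ∩ U) ⊆ {0} := by rintro _ ⟨x, hx, rfl⟩; exact h0 x hx
    exact Set.Infinite.of_accPt hacc ((Set.finite_singleton 0).subset hs)
  exact h2 h1

/-- Near each point a submanifold is the zero set of a submersion. -/
lemma IsSubmanifold.exists_submersion {k : WithTop ℕ∞} {d : ℕ} (hk : 1 ≤ k)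
    {M : Set (EuclideanSpace ℝ (Fin n))}
    (hM : IsSubmanifold k d M) {p : EuclideanSpace ℝ (Fin n)} (hp : p ∈ M) :
    ∃ (q : EuclideanSpace ℝ (Fin n) → (Fin (n - d) → ℝ))
      (q' : EuclideanSpace ℝ (Fin n) →L[ℝ] (Fin (n - d) → ℝ)),
      ContDiffAt ℝ 1 q p ∧ HasFDerivAt q q' p ∧ (∀ᶠ x in 𝓝 p, x ∈ M ↔ q x = 0) ∧
      tangentSpace M p = q'.ker ∧ Function.Surjective q' := by
  obtain ⟨hdn, hM⟩ := hM
  obtain ⟨Φ, hpΦ, ⟨hΦ, hΦs⟩, hMΦ⟩ := hM p hp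
  have hs : Φ.source ∈ 𝓝 p := Φ.open_source.mem_nhds hpΦ
  have hc : ContDiffAt ℝ 1 Φ p := (hΦ.contDiffAt hs).of_le hk
  have hcs : ContDiffAt ℝ 1 Φ.symm (Φ p) :=
    (hΦs.contDiffAt (Φ.open_target.mem_nhds (Φ.map_source hpΦ))).of_le hk
  -- The last `n - d` coordinates, whose common zero set is the model `flat n d`; the submersion is
  -- `Q ∘ Φ`.
  set Q : EuclideanSpace ℝ (Fin n) →L[ℝ] (Fin (n - d) → ℝ) :=
    ContinuousLinearMap.pi fun j => EuclideanSpace.proj (⟨d + j, by omega⟩ : Fin n) with hQ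
  have hQflat : ∀ z, Q z = 0 ↔ z ∈ flat n d := by
    intro z
    constructor
    · intro h i hi
      have := congrFun h ⟨i - d, by omega⟩
      have hi' : (⟨d + (i - d), by omega⟩ : Fin n) = i := by ext; simp; omega
      change z ⟨d + (i - d), by omega⟩ = 0 at this
      rwa [hi'] at this
    · intro h
      ext j
      exact h _ (by simp)
  have hQsurj : Function.Surjective Q := by
    intro w
    refine ⟨WithLp.toLp 2 fun i => if h : d ≤ i then w ⟨i - d, by omega⟩ else 0, ?_⟩
    ext j
    simp [hQ]
  have h1 : HasFDerivAt Φ (fderiv ℝ Φ p) p := (hc.differentiableAt one_ne_zero).hasFDerivAt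
  have h2 : HasFDerivAt Φ.symm (fderiv ℝ Φ.symm (Φ p)) (Φ p) :=
    (hcs.differentiableAt one_ne_zero).hasFDerivAt
  have hinv : ∀ w, fderiv ℝ Φ p (fderiv ℝ Φ.symm (Φ p) w) = w := by
    intro w
    have h1' : HasFDerivAt Φ (fderiv ℝ Φ p) (Φ.symm (Φ p)) := by rwa [Φ.left_inv hpΦ]
    have h3 := h1'.comp (Φ p) h2
    have h4 : HasFDerivAt (Φ ∘ Φ.symm) (ContinuousLinearMap.id ℝ _) (Φ p) := by
      refine (hasFDerivAt_id _).congr_of_eventuallyEq ?_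
      filter_upwards [Φ.open_target.mem_nhds (Φ.map_source hpΦ)] with z hz
      exact Φ.right_inv hz
    exact congrArg (fun (f : _ →L[ℝ] _) => f w) (h3.unique h4)
  have hinv' : ∀ w, fderiv ℝ Φ.symm (Φ p) (fderiv ℝ Φ p w) = w := by
    intro w
    have h3 := h2.comp p h1
    have h4 : HasFDerivAt (Φ.symm ∘ Φ) (ContinuousLinearMap.id ℝ _) p := by
      refine (hasFDerivAt_id _).congr_of_eventuallyEq ?_
      filter_upwards [hs] with z hz
      exact Φ.left_inv hz
    exact congrArg (fun (f : _ →L[ℝ] _) => f w) (h3.unique h4)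
  have hqd : HasFDerivAt (fun x => Q (Φ x)) (Q ∘L fderiv ℝ Φ p) p := Q.hasFDerivAt.comp p h1
  refine ⟨fun x => Q (Φ x), Q ∘L fderiv ℝ Φ p, Q.contDiff.contDiffAt.comp p hc, hqd, ?_, ?_, ?_⟩
  · filter_upwards [hs] with x hx
    rw [hMΦ x hx, hQflat]
  · apply le_antisymm
    · refine tangentSpace_le_ker hqd hs fun x hx => ?_
      exact (hQflat _).2 ((hMΦ x hx.2).1 hx.1)
    · intro w hw
      have hw' : fderiv ℝ Φ p w ∈ flat n d := (hQflat _).1 hw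
      -- A vector `w` of the kernel is the velocity at `p` of the curve in `M` obtained by pulling
      -- back a straight line of `flat n d` through the chart.
      have hγ : HasFDerivAt (fun τ : ℝ => Φ p + τ • fderiv ℝ Φ p w)
          (ContinuousLinearMap.toSpanSingleton ℝ (fderiv ℝ Φ p w)) 0 := by
        exact (ContinuousLinearMap.toSpanSingleton ℝ (fderiv ℝ Φ p w)).hasFDerivAt.const_add _
      have h2' : HasFDerivAt Φ.symm (fderiv ℝ Φ.symm (Φ p))
          (Φ p + (0 : ℝ) • fderiv ℝ Φ p w) := by simpa using h2
      have h3 := h2'.comp (0 : ℝ) hγ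
      have h4 := fderiv_mem_tangentSpace (M := M) h3 ?_ 1
      · simpa [hinv', Φ.left_inv hpΦ] using h4
      · have hcont : ContinuousAt (fun τ : ℝ => Φ p + τ • fderiv ℝ Φ p w) 0 := hγ.continuousAt
        have : ∀ᶠ τ : ℝ in 𝓝 0, Φ p + τ • fderiv ℝ Φ p w ∈ Φ.target :=
          hcont.eventually_mem (Φ.open_target.mem_nhds (by simpa using Φ.map_source hpΦ))
        filter_upwards [this] with τ hτ
        have h5 := Φ.map_target hτ
        simp only [Function.comp]
        rw [hMΦ _ h5, Φ.right_inv hτ]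
        intro i hi
        have a1 := (hMΦ p hpΦ).1 hp i hi
        have a2 := hw' i hi
        simp [a1, a2]
  · exact hQsurj.comp fun w => ⟨_, hinv w⟩

lemma IsSubmanifold.finrank_tangentSpace {k : WithTop ℕ∞} {d : ℕ} (hk : 1 ≤ k)
    {M : Set (EuclideanSpace ℝ (Fin n))}
    (hM : IsSubmanifold k d M) {p : EuclideanSpace ℝ (Fin n)} (hp : p ∈ M) :
    Module.finrank ℝ (tangentSpace M p) = d := by
  obtain ⟨q, q', -, -, -, hker, hsurj⟩ := hM.exists_submersion hk hp
  rw [hker]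
  have h1 := q'.toLinearMap.finrank_range_add_finrank_ker
  have h2 : Module.finrank ℝ q'.toLinearMap.range = n - d := by
    rw [LinearMap.range_eq_top.2 hsurj]; simp
  have := hM.1
  rw [h2] at h1
  simp at h1
  have h3 : Module.finrank ℝ q'.ker = Module.finrank ℝ q'.toLinearMap.ker := rfl
  omega

/-- The `C^1` inverse function theorem. -/
lemma exists_openPartialHomeomorph_contDiffOn {E F : Type*} [NormedAddCommGroup E]
    [NormedSpace ℝ E] [CompleteSpace E]
    [NormedAddCommGroup F] [NormedSpace ℝ F] {f : E → F} {f' : E ≃L[ℝ] F} {a : E}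
    (hf : ContDiffAt ℝ 1 f a) (hf' : HasFDerivAt f (f' : E →L[ℝ] F) a) :
    ∃ φ : OpenPartialHomeomorph E F, a ∈ φ.source ∧ ⇑φ = f ∧
      ContDiffOn ℝ 1 φ φ.source ∧ ContDiffOn ℝ 1 φ.symm φ.target := by
  set ψ := hf.toOpenPartialHomeomorph f hf' one_ne_zero with hψ
  have hsymm : ContDiffAt ℝ 1 ψ.symm (f a) := hf.to_localInverse hf' one_ne_zero
  -- The inverse function theorem gives regularity at `a` and `f a` only; being `C^1` is an open
  -- condition, so the homeomorphism is restricted to where both it and its inverse are `C^1`.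
  have hne : (1 : WithTop ℕ∞) ≠ (⊤ : ℕ∞) := by decide
  exact ⟨ψ.restrContDiff ℝ 1 hne,
    ⟨hf.mem_toOpenPartialHomeomorph_source hf' one_ne_zero, hf, hsymm⟩, rfl,
    ψ.contDiffOn_restrContDiff_source ℝ hne, ψ.contDiffOn_restrContDiff_target ℝ hne⟩

/-- A submanifold is, near a point, the graph of a `C^1` local section of every `C^1` map whose
derivative restricts to an isomorphism on the tangent space. -/
lemma IsSubmanifold.exists_section {k : WithTop ℕ∞} {d : ℕ} (hk : 1 ≤ k) [FiniteDimensional ℝ F]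
    (hF : Module.finrank ℝ F = d) {M : Set (EuclideanSpace ℝ (Fin n))}
    (hM : IsSubmanifold k d M) {p : EuclideanSpace ℝ (Fin n)} (hp : p ∈ M)
    {G : EuclideanSpace ℝ (Fin n) → F} {G' : EuclideanSpace ℝ (Fin n) →L[ℝ] F}
    (hG : ContDiffAt ℝ 1 G p) (hG' : HasFDerivAt G G' p)
    (hinj : ∀ w ∈ tangentSpace M p, G' w = 0 → w = 0) :
    ∃ (U : Set (EuclideanSpace ℝ (Fin n))) (W : Set F) (g : F → EuclideanSpace ℝ (Fin n)),
      IsOpen U ∧ p ∈ U ∧ IsOpen W ∧ ContDiffOn ℝ 1 g W ∧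
      (∀ z ∈ W, g z ∈ M ∩ U ∧ G (g z) = z) ∧ (∀ x ∈ M ∩ U, G x ∈ W ∧ g (G x) = x) := by
  obtain ⟨q, q', hq, hq', hMq, hker, hsurj⟩ := hM.exists_submersion hk hp
  -- The kernel of `q'` is the tangent space, on which `G'` is injective, and the dimensions `d + (n
  -- - d) = n` agree. The section is then the inverse of `(G, q)` on the slice `q = 0`.
  have hbij : Function.Bijective (G'.prod q') := by
    have hi : Function.Injective (G'.prod q').toLinearMap := by
      rw [injective_iff_map_eq_zero]
      intro w hw
      have h1 : G' w = 0 := congrArg Prod.fst hw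
      have h2 : q' w = 0 := congrArg Prod.snd hw
      exact hinj w (by rw [hker]; exact h2) h1
    refine ⟨hi, ?_⟩
    have := hM.1
    exact (LinearMap.injective_iff_surjective_of_finrank_eq_finrank (by simp [hF]; omega)).1 hi
  set e : EuclideanSpace ℝ (Fin n) ≃L[ℝ] F × (Fin (n - d) → ℝ) :=
    (LinearEquiv.ofBijective (G'.prod q').toLinearMap hbij).toContinuousLinearEquiv with he
  obtain ⟨φ, hpφ, hφ, hφc, hφs⟩ := exists_openPartialHomeomorph_contDiffOn (f' := e)
    (hG.prodMk hq) (hG'.prodMk hq')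
  obtain ⟨V, hV, hVo, hpV⟩ := eventually_nhds_iff.1 hMq
  set ψ := φ.restrOpen V hVo with hψ
  have hψc : ∀ x, ψ x = (G x, q x) := fun x => congrFun hφ x
  have hmem : ∀ z ∈ ψ.target, φ.symm z ∈ φ.source ∩ V := fun z hz => ψ.map_target hz
  have hsub : ψ.target ⊆ φ.target := by
    intro z hz
    have := ψ.right_inv hz
    have h2 : φ (φ.symm z) = z := this
    rw [← h2]; exact φ.map_source (hmem z hz).1
  refine ⟨ψ.source, {z | (z, 0) ∈ ψ.target}, fun z => φ.symm (z, 0), ψ.open_source,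
    ⟨hpφ, hpV⟩, ψ.open_target.preimage (by fun_prop), ?_, ?_, ?_⟩
  · refine (hφs.mono hsub).comp (f := fun z : F => (z, (0 : Fin (n - d) → ℝ))) ?_ fun z hz => hz
    fun_prop
  · intro z hz
    have h1 := hmem _ hz
    have h2 : ψ (ψ.symm (z, 0)) = (z, 0) := ψ.right_inv hz
    rw [hψc] at h2
    exact ⟨⟨(hV _ h1.2).2 (congrArg Prod.snd h2), h1⟩, congrArg Prod.fst h2⟩
  · rintro x ⟨hxM, hx⟩
    have h0 : q x = 0 := (hV x hx.2).1 hxM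
    have h1 := ψ.map_source hx
    have h2 : ψ.symm (ψ x) = x := ψ.left_inv hx
    rw [hψc, h0] at h1 h2
    exact ⟨h1, h2⟩

end Submanifold

/-! ### Perturbation of right inverses -/

section Linear

variable {E B : Type*} [NormedAddCommGroup E] [NormedSpace ℝ E] [NormedAddCommGroup B]
  [NormedSpace ℝ B] [FiniteDimensional ℝ E] [FiniteDimensional ℝ B]

/-- If `D ∘ Λ = id` and the subspace `T`, of dimension at most that of `B`, almost contains the
range of `Λ`, then `D` is injective on `T`. -/
lemma injOn_of_approx {T : Submodule ℝ E} (hT : Module.finrank ℝ T ≤ Module.finrank ℝ B)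
    {Λ : B →L[ℝ] E} {D : E →L[ℝ] B} (hD : ∀ b, D (Λ b) = b) {c ε : ℝ} (hc : ‖D‖ ≤ c)
    (hcε : c * ε ≤ 1 / 2) (h : ∀ b, ∃ w ∈ T, ‖w - Λ b‖ ≤ ε * ‖b‖) :
    ∀ w ∈ T, D w = 0 → w = 0 := by
  have hc0 : 0 ≤ c := (norm_nonneg _).trans hc
  have key : ∀ b, ∃ w ∈ T, ‖b - D w‖ ≤ 1 / 2 * ‖b‖ := by
    intro b
    obtain ⟨w, hw, hwb⟩ := h b
    refine ⟨w, hw, ?_⟩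
    calc ‖b - D w‖ = ‖D (w - Λ b)‖ := by rw [map_sub, hD, norm_sub_rev]
      _ ≤ c * (ε * ‖b‖) := (D.le_opNorm _).trans (by gcongr)
      _ = c * ε * ‖b‖ := by ring
      _ ≤ 1 / 2 * ‖b‖ := by gcongr
  set DT : T →ₗ[ℝ] B := D.toLinearMap ∘ₗ T.subtype with hDT
  have hsurj : Function.Surjective DT := by
    rw [← LinearMap.range_eq_top]
    by_contra hne
    -- A proper range would leave a nonzero `b` at distance at least `3/4 ‖b‖` from it, whereas
    -- `key` approximates `b` within `1/2 ‖b‖`.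
    obtain ⟨b, hb, hb'⟩ := riesz_lemma (F := LinearMap.range DT)
      (Submodule.closed_of_finiteDimensional _) (by
        by_contra hcon
        push Not at hcon
        exact hne (eq_top_iff.2 fun x _ => hcon x)) (r := 3 / 4) (by norm_num)
    obtain ⟨w, hw, hwb⟩ := key b
    have h1 := hb' (D w) ⟨⟨w, hw⟩, rfl⟩
    have h2 : ‖b‖ = 0 := by
      have := norm_nonneg b
      linarith
    exact hb (by rw [norm_eq_zero.1 h2]; exact Submodule.zero_mem _)
  have hfin : Module.finrank ℝ T = Module.finrank ℝ B :=
    le_antisymm hT (LinearMap.finrank_le_finrank_of_surjective hsurj)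
  have hinj := (LinearMap.injective_iff_surjective_of_finrank_eq_finrank hfin).2 hsurj
  intro w hw hw0
  have : (⟨w, hw⟩ : T) = 0 := hinj (by simpa [hDT] using hw0)
  exact congrArg Subtype.val this

/-- A right inverse of `D` with values in `T` is close to `Λ`. -/
lemma norm_sub_le_of_approx {T : Submodule ℝ E} (hT : Module.finrank ℝ T ≤ Module.finrank ℝ B)
    {Λ : B →L[ℝ] E} {D : E →L[ℝ] B} (hD : ∀ b, D (Λ b) = b) {c ε : ℝ} (hc : ‖D‖ ≤ c)
    (hε : 0 ≤ ε) (hcε : c * ε ≤ 1 / 2) (h : ∀ b, ∃ w ∈ T, ‖w - Λ b‖ ≤ ε * ‖b‖)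
    {S : B →L[ℝ] E} (hS : ∀ b, S b ∈ T) (hDS : ∀ b, D (S b) = b) :
    ‖S - Λ‖ ≤ ε * (2 + 2 * c * ‖Λ‖) := by
  have hc0 : 0 ≤ c := (norm_nonneg _).trans hc
  have hinj := injOn_of_approx hT hD hc hcε h
  have hSD : ∀ w ∈ T, S (D w) = w := by
    intro w hw
    refine sub_eq_zero.1 (hinj _ (T.sub_mem (hS _) hw) ?_)
    rw [map_sub, hDS, sub_self]
  have h1 : ‖S - Λ‖ ≤ ε + ‖S‖ * (c * ε) := by
    refine ContinuousLinearMap.opNorm_le_bound _ (by positivity) fun b => ?_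
    obtain ⟨w, hw, hwb⟩ := h b
    -- Here `S b = S (D (Λ b))` and `S (D w) = w`, so the error of `S` is expressed through the
    -- small vector `w - Λ b`. The unknown `‖S‖` in the resulting bound is absorbed by `c * ε ≤ 1 /
    -- 2`.
    have e : (S - Λ) b = (w - Λ b) - S (D (w - Λ b)) := by
      rw [map_sub D, hD, map_sub S, hSD w hw]
      simp
    rw [e]
    calc ‖(w - Λ b) - S (D (w - Λ b))‖ ≤ ‖w - Λ b‖ + ‖S‖ * (c * ‖w - Λ b‖) := by
          refine (norm_sub_le _ _).trans ?_
          gcongr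
          refine (S.le_opNorm _).trans ?_
          gcongr
          exact (D.le_opNorm _).trans (by gcongr)
      _ ≤ ε * ‖b‖ + ‖S‖ * (c * (ε * ‖b‖)) := by gcongr
      _ = (ε + ‖S‖ * (c * ε)) * ‖b‖ := by ring
  have h2 : ‖S‖ ≤ ‖S - Λ‖ + ‖Λ‖ := by
    simpa using norm_add_le (S - Λ) Λ
  have h3 : ‖S‖ ≤ 2 * (ε + ‖Λ‖) := by
    have : ‖S‖ * (c * ε) ≤ ‖S‖ * (1 / 2) := by gcongr
    linarith
  calc ‖S - Λ‖ ≤ ε + ‖S‖ * (c * ε) := h1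
    _ ≤ ε + (2 * (ε + ‖Λ‖)) * (c * ε) := by gcongr
    _ = ε * (1 + 2 * (c * ε) + 2 * c * ‖Λ‖) := by ring
    _ ≤ ε * (2 + 2 * c * ‖Λ‖) := by gcongr; linarith

end Linear

/-! ### Sections of proper local homeomorphisms -/

section Covering

variable {E B : Type*} [TopologicalSpace E] [T2Space E] [NormedAddCommGroup B] [NormedSpace ℝ B]

/-- A proper local homeomorphism over a convex open set has a section through every point of its
source, and the section exhausts every connected set containing that point. -/
lemma exists_global_section {Y : Set E} {f : E → B} {O : Set B} (hO : IsOpen O) (hOc : Convex ℝ O)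
    (hf : ContinuousOn f (Y ∩ f ⁻¹' O))
    (hproper : ∀ K ⊆ O, IsCompact K → IsCompact (Y ∩ f ⁻¹' K))
    (hloc : ∀ y ∈ Y, f y ∈ O → ∃ (U : Set E) (W : Set B) (g : B → E), IsOpen U ∧ y ∈ U ∧ IsOpen W ∧
      ContinuousOn g W ∧ (∀ z ∈ W, g z ∈ Y ∩ U ∧ f (g z) = z) ∧
      (∀ x ∈ Y ∩ U, f x ∈ W ∧ g (f x) = x))
    {y₀ : E} (hy₀ : y₀ ∈ Y) (hfy₀ : f y₀ ∈ O) :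
    ∃ s : B → E, ContinuousOn s O ∧ (∀ z ∈ O, s z ∈ Y ∧ f (s z) = z) ∧
      ∀ C ⊆ Y ∩ f ⁻¹' O, IsPreconnected C → y₀ ∈ C → ∀ y ∈ C, s (f y) = y := by
  set Y' : Set E := Y ∩ f ⁻¹' O with hY'
  let p : Y' → O := fun y => ⟨f y, y.2.2⟩
  have hp : Continuous p := (continuousOn_iff_continuous_domRestrict.1 hf).subtype_mk _
  have hpp : IsProperMap p := by
    refine isProperMap_iff_isCompact_preimage.2 ⟨hp, fun K hK => ?_⟩
    have h1 := hproper (Subtype.val '' K) (by rintro _ ⟨z, -, rfl⟩; exact z.2)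
      (hK.image continuous_subtype_val)
    rw [Subtype.isCompact_iff]
    convert h1 using 1
    ext y
    constructor
    · rintro ⟨⟨y, hy⟩, hyK, rfl⟩
      exact ⟨hy.1, _, hyK, rfl⟩
    · rintro ⟨hy, z, hzK, hz⟩
      have hyO : f y ∈ O := by rw [← hz]; exact z.2
      refine ⟨⟨y, hy, hyO⟩, ?_, rfl⟩
      have : p ⟨y, hy, hyO⟩ = z := Subtype.ext hz.symm
      simpa [this] using hzK
  have hlh : IsLocalHomeomorph p := by
    intro y
    obtain ⟨U, W, g, hU, hyU, hW, hg, hgW, hgU⟩ := hloc y y.2.1 y.2.2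
    have hgm : ∀ z : O, (z : B) ∈ W → g z ∈ Y' := fun z hz => ⟨(hgW z hz).1.1, by
      rw [mem_preimage, (hgW z hz).2]; exact z.2⟩
    classical
    let φ : OpenPartialHomeomorph Y' O :=
      { toFun := p
        invFun := fun z => if hz : (z : B) ∈ W then ⟨g z, hgm z hz⟩ else y
        source := {x | (x : E) ∈ U}
        target := {z | (z : B) ∈ W}
        map_source' := fun x hx => (hgU x ⟨x.2.1, hx⟩).1
        map_target' := fun z hz => by
          have hz' : (z : B) ∈ W := hz
          simp only [dif_pos hz']
          exact (hgW z hz').1.2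
        left_inv' := fun x hx => by
          have h := hgU x ⟨x.2.1, hx⟩
          have hz' : ((p x : O) : B) ∈ W := h.1
          simp only [dif_pos hz']
          exact Subtype.ext h.2
        right_inv' := fun z hz => by
          have hz' : (z : B) ∈ W := hz
          simp only [dif_pos hz']
          exact Subtype.ext (hgW z hz').2
        open_source := hU.preimage continuous_subtype_val
        open_target := hW.preimage continuous_subtype_val
        continuousOn_toFun := hp.continuousOn
        continuousOn_invFun := by
          rw [continuousOn_iff_continuous_domRestrict, continuous_induced_rng]
          have : Continuous (fun z : {z : O | (z : B) ∈ W} => g z.1) :=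
            hg.comp_continuous (by fun_prop) fun z => z.2
          convert this using 2 with z
          have hz : ((z : O) : B) ∈ W := z.2
          simp [dif_pos hz] }
    exact ⟨φ, hyU, rfl⟩
  -- Fibres are compact by properness and discrete because `p` is a local homeomorphism, hence
  -- finite; a closed local homeomorphism with finite fibres is a covering.
  have hcov : IsCoveringMap p := by
    rw [isCoveringMap_iff_isCoveringMapOn_univ]
    refine hpp.isClosedMap.isCoveringMapOn_of_isLocalHomeomorphOn (fun z _ => ?_) ?_
    · have hc : IsCompact (p ⁻¹' {z}) := hpp.isCompact_preimage isCompact_singleton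
      refine hc.finite (IsDiscrete.of_openPartialHomeomorph p subset_rfl fun e _ => ?_)
      obtain ⟨φ, h1, h2⟩ := hlh e
      exact ⟨φ, h1, h2.symm⟩
    · exact hlh.isLocalHomeomorphOn.mono (subset_univ _)
  have : ContractibleSpace O := hOc.contractibleSpace ⟨_, hfy₀⟩
  have : LocallyPathConnectedSpace O := hO.locallyPathConnectedSpace
  obtain ⟨F, ⟨hF0, hF⟩, -⟩ := hcov.existsUnique_continuousMap_lifts (ContinuousMap.id O)
    ⟨f y₀, hfy₀⟩ ⟨y₀, hy₀, hfy₀⟩ rfl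
  have hF' : ∀ z, p (F z) = z := fun z => congrFun hF z
  classical
  refine ⟨fun z => if hz : z ∈ O then F ⟨z, hz⟩ else y₀, ?_, ?_, ?_⟩
  · rw [continuousOn_iff_continuous_domRestrict]
    have : Continuous fun z : O => ((F z : Y') : E) := by fun_prop
    convert this using 2 with z
    simp
  · intro z hz
    simp only [dif_pos hz]
    exact ⟨(F ⟨z, hz⟩).2.1, congrArg Subtype.val (hF' ⟨z, hz⟩)⟩
  · intro C hC hCc hy₀C y hy
    have : PreconnectedSpace C := Subtype.preconnectedSpace hCc
    -- On `C` both the inclusion and the section after `p` lift `p`, and they agree at `y₀`;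
    -- uniqueness of lifts on a connected space makes them equal.
    have h := hcov.eq_of_comp_eq (A := C) (g₁ := fun c => F (p ⟨c, hC c.2⟩))
      (g₂ := fun c => ⟨c, hC c.2⟩) (by fun_prop) (by fun_prop)
      (by ext c; simp [hF']) ⟨y₀, hy₀C⟩ hF0
    have h2 := congrArg Subtype.val (congrFun h ⟨y, hy⟩)
    have hfy : f y ∈ O := (hC hy).2
    simp only [dif_pos hfy]
    exact h2

end Covering

/-! ### Condition (b) in terms of the frame over a graph -/

section Frame

variable {n : ℕ} {A : Type*} [NormedAddCommGroup A] [NormedSpace ℝ A]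

/-- In the open set `U`, the set `X` is the image of the `C^1` section `g`, defined on the open
set `W`, of the linear map `P`. -/
structure IsGraphOn (X : Set (EuclideanSpace ℝ (Fin n))) (P : EuclideanSpace ℝ (Fin n) →L[ℝ] A)
    (g : A → EuclideanSpace ℝ (Fin n)) (U : Set (EuclideanSpace ℝ (Fin n))) (W : Set A) :
    Prop where
  isOpen_source : IsOpen U
  isOpen_base : IsOpen W
  contDiffOn : ContDiffOn ℝ 1 g W
  mem_of_mem_base : ∀ a ∈ W, g a ∈ X ∩ U ∧ P (g a) = a
  eq_of_mem : ∀ x ∈ X ∩ U, P x ∈ W ∧ g (P x) = x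

/-- The unit vector pointing from the point `g (P y)` under `y` to `y`. -/
def direction (P : EuclideanSpace ℝ (Fin n) →L[ℝ] A) (g : A → EuclideanSpace ℝ (Fin n))
    (y : EuclideanSpace ℝ (Fin n)) : EuclideanSpace ℝ (Fin n) :=
  ‖y - g (P y)‖⁻¹ • (y - g (P y))

/-- The linear map sending `(v, σ)` to the sum of the lift of `v` to the tangent space of the graph
and of `σ` times the direction of `y`. -/
def frame (P : EuclideanSpace ℝ (Fin n) →L[ℝ] A) (g : A → EuclideanSpace ℝ (Fin n))
    (y : EuclideanSpace ℝ (Fin n)) : A × ℝ →L[ℝ] EuclideanSpace ℝ (Fin n) :=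
  (fderiv ℝ g (P y)).coprod (ContinuousLinearMap.toSpanSingleton ℝ (direction P g y))

@[simp] lemma frame_apply (P : EuclideanSpace ℝ (Fin n) →L[ℝ] A)
    (g : A → EuclideanSpace ℝ (Fin n)) (y : EuclideanSpace ℝ (Fin n)) (b : A × ℝ) :
    frame P g y b = fderiv ℝ g (P y) b.1 + b.2 • direction P g y := by
  simp [frame]

lemma exists_mem_norm_sub_le_of_subspaceDist_lt {T S : Submodule ℝ (EuclideanSpace ℝ (Fin n))}
    {η : ℝ} (h : subspaceDist T S < η) {v : EuclideanSpace ℝ (Fin n)} (hv : v ∈ T) :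
    ∃ w ∈ S, ‖w - v‖ ≤ η * ‖v‖ := by
  by_cases hv0 : v = 0
  · exact ⟨0, S.zero_mem, by simp [hv0]⟩
  have hpos : 0 < ‖v‖ := norm_pos_iff.2 hv0
  -- The distances are at most `1`, since `0 ∈ S`; without this bound `sSup` would be a default
  -- value and carry no information.
  have hbdd : BddAbove ((fun v => Metric.infDist v (S : Set (EuclideanSpace ℝ (Fin n)))) ''
      {v | v ∈ T ∧ ‖v‖ = 1}) := by
    refine ⟨1, ?_⟩
    rintro _ ⟨u, ⟨-, hu⟩, rfl⟩
    refine (Metric.infDist_le_dist_of_mem S.zero_mem).trans ?_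
    simp [hu]
  have h1 : Metric.infDist (‖v‖⁻¹ • v) (S : Set (EuclideanSpace ℝ (Fin n))) < η :=
    (le_csSup hbdd ⟨‖v‖⁻¹ • v, ⟨T.smul_mem _ hv, by simp [norm_smul, hpos.ne']⟩, rfl⟩).trans_lt h
  obtain ⟨w, hw, hwη⟩ := (Metric.infDist_lt_iff ⟨0, S.zero_mem⟩).1 h1
  refine ⟨‖v‖ • w, S.smul_mem _ hw, ?_⟩
  have e : ‖v‖ • w - v = ‖v‖ • (w - ‖v‖⁻¹ • v) := by
    rw [smul_sub, smul_smul, mul_inv_cancel₀ hpos.ne', one_smul]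
  rw [e, norm_smul, norm_norm, mul_comm η]
  rw [dist_comm, dist_eq_norm] at hwη
  gcongr

/-- Since `x` competes for the nearest point, `π y` is within `2 * dist y x` of `x`. -/
lemma IsNearestPointRetraction.tendsto {X : Set (EuclideanSpace ℝ (Fin n))}
    {x : EuclideanSpace ℝ (Fin n)} {π : EuclideanSpace ℝ (Fin n) → EuclideanSpace ℝ (Fin n)}
    (h : IsNearestPointRetraction X x π) (hx : x ∈ X) : Tendsto π (𝓝 x) (𝓝 x) := by
  rw [tendsto_iff_dist_tendsto_zero]
  have h2 : Tendsto (fun y => 2 * dist y x) (𝓝 x) (𝓝 0) := by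
    have : Continuous fun y => 2 * dist y x := by fun_prop
    simpa using this.tendsto x
  refine squeeze_zero' (Eventually.of_forall fun y => dist_nonneg) ?_ h2
  filter_upwards [h] with y hy
  have h3 := hy.2 x hx
  have h4 := dist_triangle_left (π y) x y
  linarith

lemma IsGraphOn.contDiffAt {X U : Set (EuclideanSpace ℝ (Fin n))}
    {P : EuclideanSpace ℝ (Fin n) →L[ℝ] A} {g : A → EuclideanSpace ℝ (Fin n)} {W : Set A}
    (h : IsGraphOn X P g U W) {a : A} (ha : a ∈ W) : ContDiffAt ℝ 1 g a :=
  h.contDiffOn.contDiffAt (h.isOpen_base.mem_nhds ha)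

lemma IsGraphOn.hasFDerivAt {X U : Set (EuclideanSpace ℝ (Fin n))}
    {P : EuclideanSpace ℝ (Fin n) →L[ℝ] A} {g : A → EuclideanSpace ℝ (Fin n)} {W : Set A}
    (h : IsGraphOn X P g U W) {a : A} (ha : a ∈ W) : HasFDerivAt g (fderiv ℝ g a) a :=
  ((h.contDiffAt ha).differentiableAt one_ne_zero).hasFDerivAt

lemma IsGraphOn.continuousAt_fderiv {X U : Set (EuclideanSpace ℝ (Fin n))}
    {P : EuclideanSpace ℝ (Fin n) →L[ℝ] A} {g : A → EuclideanSpace ℝ (Fin n)} {W : Set A}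
    (h : IsGraphOn X P g U W) {a : A} (ha : a ∈ W) : ContinuousAt (fderiv ℝ g) a :=
  (h.contDiffOn.continuousOn_fderiv_of_isOpen h.isOpen_base le_rfl).continuousAt
    (h.isOpen_base.mem_nhds ha)

lemma IsGraphOn.fderiv_mem_tangentSpace {X U : Set (EuclideanSpace ℝ (Fin n))}
    {P : EuclideanSpace ℝ (Fin n) →L[ℝ] A} {g : A → EuclideanSpace ℝ (Fin n)} {W : Set A}
    (h : IsGraphOn X P g U W) {a : A} (ha : a ∈ W) (v : A) :
    fderiv ℝ g a v ∈ tangentSpace X (g a) := by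
  refine WhitneyPawlucki.fderiv_mem_tangentSpace (h.hasFDerivAt ha) ?_ v
  filter_upwards [h.isOpen_base.mem_nhds ha] with b hb
  exact (h.mem_of_mem_base b hb).1.1

/-- Whitney's condition `(b)` says that the tangent spaces of `Y` almost contain the frame. -/
lemma IsGraphOn.eventually_frame_approx {X Y U : Set (EuclideanSpace ℝ (Fin n))}
    {P : EuclideanSpace ℝ (Fin n) →L[ℝ] A} {g : A → EuclideanSpace ℝ (Fin n)} {W : Set A}
    (h : IsGraphOn X P g U W) (hdisj : Disjoint X Y) {x : EuclideanSpace ℝ (Fin n)}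
    (hx : x ∈ X ∩ U) (hb : WhitneyBAt Y X x) {ε : ℝ} (hε : 0 < ε) :
    ∀ᶠ y in 𝓝[Y] x, ∀ b, ∃ w ∈ tangentSpace Y y, ‖w - frame P g y b‖ ≤ ε * ‖b‖ := by
  obtain ⟨π, hπ, hα, hβ⟩ := hb
  have hxW := (h.eq_of_mem x hx).1
  set K := ‖fderiv ℝ g (P x)‖ with hK
  -- The denominator adds the error `K + 3` of the lifted tangent vectors and the error `1 + (K + 5)
  -- * ‖P‖` of the direction found below.
  set η := min 1 (ε / (K + 4 + (K + 5) * ‖P‖)) with hη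
  have hCpos : 0 < K + 4 + (K + 5) * ‖P‖ := by positivity
  have hηpos : 0 < η := lt_min one_pos (by positivity)
  have hη1 : η ≤ 1 := min_le_left _ _
  have hηε : η * (K + 4 + (K + 5) * ‖P‖) ≤ ε := by
    have : η ≤ ε / (K + 4 + (K + 5) * ‖P‖) := min_le_right _ _
    rwa [le_div_iff₀ hCpos] at this
  have hP : Tendsto (fun y => P y) (𝓝[Y] x) (𝓝 (P x)) :=
    (P.continuous.tendsto x).mono_left nhdsWithin_le_nhds
  have hπx : Tendsto π (𝓝[Y] x) (𝓝 x) := (hπ.tendsto hx.1).mono_left nhdsWithin_le_nhds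
  have hPπ : Tendsto (fun y => P (π y)) (𝓝[Y] x) (𝓝 (P x)) := (P.continuous.tendsto x).comp hπx
  have hg' : ∀ᶠ a in 𝓝 (P x), ‖fderiv ℝ g a - fderiv ℝ g (P x)‖ < η := by
    have := Metric.tendsto_nhds.1 (h.continuousAt_fderiv hxW) η hηpos
    simpa [dist_eq_norm] using this
  have hstrict : ∀ᶠ z : A × A in 𝓝 (P x, P x),
      ‖g z.1 - g z.2 - fderiv ℝ g (P x) (z.1 - z.2)‖ ≤ η * ‖z.1 - z.2‖ :=
    ((h.contDiffAt hxW).hasStrictFDerivAt one_ne_zero).isLittleO.def hηpos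
  filter_upwards [hπ.filter_mono nhdsWithin_le_nhds, hα.eventually_lt_const hηpos,
    hβ.eventually_lt_const hηpos, hP.eventually hg', hPπ.eventually hg',
    (hP.prodMk_nhds hPπ).eventually hstrict, hπx.eventually (h.isOpen_source.mem_nhds hx.2),
    hP.eventually (h.isOpen_base.mem_nhds hxW), hPπ.eventually (h.isOpen_base.mem_nhds hxW),
    self_mem_nhdsWithin] with y hy hαy hβy hg1 hg2 hst hπU hyW hπW hyY
  set a := P y with ha
  set a' := P (π y) with ha'
  have hgπ : g a' = π y := (h.eq_of_mem _ ⟨hy.1, hπU⟩).2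
  have hga : g a ∈ X := (h.mem_of_mem_base a hyW).1.1
  have hne : y ≠ g a := fun e => Set.disjoint_left.1 hdisj hga (e ▸ hyY)
  set r := ‖y - g a‖ with hr
  have hr0 : 0 < r := norm_pos_iff.2 (sub_ne_zero.2 hne)
  -- Condition (b) concerns the nearest point `π y = g a'`, the frame the point `g a`. Moving the
  -- derivative of `g` from `a'` to `a` costs `2 * η`.
  have hlift : ∀ v : A, ∃ w ∈ tangentSpace Y y, ‖w - fderiv ℝ g a v‖ ≤ η * (K + 3) * ‖v‖ := by
    intro v
    have hmem := h.fderiv_mem_tangentSpace hπW v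
    rw [hgπ] at hmem
    obtain ⟨w, hw, hwv⟩ := exists_mem_norm_sub_le_of_subspaceDist_lt hαy hmem
    refine ⟨w, hw, ?_⟩
    have hK' : ‖fderiv ℝ g a' v‖ ≤ (K + 1) * ‖v‖ := by
      refine (ContinuousLinearMap.le_opNorm _ _).trans ?_
      gcongr
      have := norm_le_norm_add_norm_sub' (fderiv ℝ g a') (fderiv ℝ g (P x))
      rw [← hK] at this
      linarith
    have h3 : ‖fderiv ℝ g a' v - fderiv ℝ g a v‖ ≤ (2 * η) * ‖v‖ := by
      rw [← _root_.sub_apply]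
      refine (ContinuousLinearMap.le_opNorm _ _).trans ?_
      gcongr
      have e : fderiv ℝ g a' - fderiv ℝ g a = (fderiv ℝ g a' - fderiv ℝ g (P x)) -
        (fderiv ℝ g a - fderiv ℝ g (P x)) := by abel
      rw [e]
      refine (norm_sub_le _ _).trans ?_
      linarith
    calc ‖w - fderiv ℝ g a v‖ ≤ ‖w - fderiv ℝ g a' v‖ + ‖fderiv ℝ g a' v - fderiv ℝ g a v‖ :=
          norm_sub_le_norm_sub_add_norm_sub _ _ _
      _ ≤ η * ((K + 1) * ‖v‖) + (2 * η) * ‖v‖ := by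
          gcongr
          exact hwv.trans (by gcongr)
      _ = η * (K + 3) * ‖v‖ := by ring
  -- Split `y - g a` as `-(π y - y) - (g a - π y)`. The first part is almost tangent by the second
  -- limit in (b); the second is a chord of `X`, close to a tangent vector by strict
  -- differentiability. Both errors are proportional to `r`, because `‖π y - y‖ ≤ r` and so `‖a -
  -- a'‖ ≤ ‖P‖ * r`; normalisation by `r` is therefore harmless.
  have hdir : ∃ w ∈ tangentSpace Y y, ‖w - direction P g y‖ ≤ η * (1 + (K + 5) * ‖P‖) := by
    have hπne : π y ≠ y := fun e => Set.disjoint_left.1 hdisj (e ▸ hy.1) hyY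
    have hl : 0 < ‖π y - y‖ := norm_pos_iff.2 (sub_ne_zero.2 hπne)
    have hlr : ‖π y - y‖ ≤ r := by
      have := hy.2 _ hga
      rwa [dist_comm, dist_eq_norm, dist_eq_norm] at this
    obtain ⟨w₂, hw₂, hw₂'⟩ := (Metric.infDist_lt_iff ⟨0, (tangentSpace Y y).zero_mem⟩).1 hβy
    obtain ⟨w₁, hw₁, hw₁'⟩ := hlift (a - a')
    have hΔ : ‖a - a'‖ ≤ ‖P‖ * r := by
      rw [ha, ha', ← map_sub]
      refine (P.le_opNorm _).trans ?_
      rw [norm_sub_rev]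
      gcongr
    have h1 : ‖(‖π y - y‖ • w₂) - (π y - y)‖ ≤ η * r := by
      have e : (‖π y - y‖ • w₂) - (π y - y) =
          ‖π y - y‖ • (w₂ - ‖π y - y‖⁻¹ • (π y - y)) := by
        rw [smul_sub, smul_smul, mul_inv_cancel₀ hl.ne', one_smul]
      rw [e, norm_smul, norm_norm, mul_comm η]
      rw [dist_comm, dist_eq_norm] at hw₂'
      gcongr
    have h2 : ‖w₁ - (g a - π y)‖ ≤ η * (K + 5) * (‖P‖ * r) := by
      have e : w₁ - (g a - π y) = (w₁ - fderiv ℝ g a (a - a')) +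
          ((fderiv ℝ g a - fderiv ℝ g (P x)) (a - a')) -
          (g a - g a' - fderiv ℝ g (P x) (a - a')) := by
        rw [hgπ, _root_.sub_apply]; abel
      rw [e]
      have h4 : ‖(fderiv ℝ g a - fderiv ℝ g (P x)) (a - a')‖ ≤ η * ‖a - a'‖ :=
        (ContinuousLinearMap.le_opNorm _ _).trans (by gcongr)
      calc _ ≤ η * (K + 3) * ‖a - a'‖ + η * ‖a - a'‖ + η * ‖a - a'‖ :=
            (norm_sub_le _ _).trans (add_le_add ((norm_add_le _ _).trans (add_le_add hw₁' h4)) hst)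
        _ = η * (K + 5) * ‖a - a'‖ := by ring
        _ ≤ _ := by gcongr
    refine ⟨r⁻¹ • (-(‖π y - y‖ • w₂) - w₁), (tangentSpace Y y).smul_mem _
      ((tangentSpace Y y).sub_mem ((tangentSpace Y y).neg_mem
        ((tangentSpace Y y).smul_mem _ hw₂)) hw₁), ?_⟩
    have e : r⁻¹ • (-(‖π y - y‖ • w₂) - w₁) - direction P g y =
        -(r⁻¹ • (((‖π y - y‖ • w₂) - (π y - y)) + (w₁ - (g a - π y)))) := by
      rw [direction, ← ha, ← hr]
      module
    rw [e, norm_neg, norm_smul, norm_inv, Real.norm_of_nonneg hr0.le, inv_mul_le_iff₀ hr0]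
    calc _ ≤ η * r + η * (K + 5) * (‖P‖ * r) := (norm_add_le _ _).trans (add_le_add h1 h2)
      _ = _ := by ring
  intro b
  obtain ⟨w, hw, hwv⟩ := hlift b.1
  obtain ⟨u, hu, hud⟩ := hdir
  refine ⟨w + b.2 • u, (tangentSpace Y y).add_mem hw ((tangentSpace Y y).smul_mem _ hu), ?_⟩
  have e : w + b.2 • u - frame P g y b =
      (w - fderiv ℝ g a b.1) + b.2 • (u - direction P g y) := by
    rw [frame_apply, smul_sub]; abel
  rw [e]
  calc _ ≤ η * (K + 3) * ‖b.1‖ + ‖b.2‖ * (η * (1 + (K + 5) * ‖P‖)) := by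
        refine (norm_add_le _ _).trans (add_le_add hwv ?_)
        rw [norm_smul]
        gcongr
    _ ≤ η * (K + 3) * ‖b‖ + ‖b‖ * (η * (1 + (K + 5) * ‖P‖)) := by
        gcongr
        · exact norm_fst_le b
        · exact norm_snd_le b
    _ = η * (K + 4 + (K + 5) * ‖P‖) * ‖b‖ := by ring
    _ ≤ ε * ‖b‖ := by gcongr

end Frame

/-! ### The foot-and-height map and tubes around a graph -/

section Section

variable {n : ℕ} {A : Type*} [NormedAddCommGroup A] [NormedSpace ℝ A]

/-- The base point and the distance to the graph of `g`. -/
def footHeight (P : EuclideanSpace ℝ (Fin n) →L[ℝ] A) (g : A → EuclideanSpace ℝ (Fin n))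
    (y : EuclideanSpace ℝ (Fin n)) : A × ℝ :=
  (P y, ‖y - g (P y)‖)

lemma norm_direction_le (P : EuclideanSpace ℝ (Fin n) →L[ℝ] A)
    (g : A → EuclideanSpace ℝ (Fin n)) (y : EuclideanSpace ℝ (Fin n)) :
    ‖direction P g y‖ ≤ 1 := by
  rw [direction, norm_smul, norm_inv, norm_norm]
  exact inv_mul_le_one

lemma norm_frame_le (P : EuclideanSpace ℝ (Fin n) →L[ℝ] A)
    (g : A → EuclideanSpace ℝ (Fin n)) (y : EuclideanSpace ℝ (Fin n)) :
    ‖frame P g y‖ ≤ ‖fderiv ℝ g (P y)‖ + 1 := by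
  refine ContinuousLinearMap.opNorm_le_bound _ (by positivity) fun b => ?_
  rw [frame_apply]
  calc _ ≤ ‖fderiv ℝ g (P y)‖ * ‖b.1‖ + ‖b.2‖ * 1 := by
        refine (norm_add_le _ _).trans (add_le_add (ContinuousLinearMap.le_opNorm _ _) ?_)
        rw [norm_smul]
        gcongr
        exact norm_direction_le P g y
    _ ≤ ‖fderiv ℝ g (P y)‖ * ‖b‖ + ‖b‖ * 1 := by
        gcongr
        · exact norm_fst_le b
        · exact norm_snd_le b
    _ = _ := by ring

variable {X Y U : Set (EuclideanSpace ℝ (Fin n))}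
    {P : EuclideanSpace ℝ (Fin n) →L[ℝ] A} {g : A → EuclideanSpace ℝ (Fin n)} {W : Set A}

lemma IsGraphOn.map_fderiv (h : IsGraphOn X P g U W) {a : A} (ha : a ∈ W) (v : A) :
    P (fderiv ℝ g a v) = v := by
  have h1 : HasFDerivAt (fun b => P (g b)) (P ∘L fderiv ℝ g a) a :=
    P.hasFDerivAt.comp a (h.hasFDerivAt ha)
  have h2 : HasFDerivAt (fun b => P (g b)) (ContinuousLinearMap.id ℝ A) a := by
    refine (hasFDerivAt_id a).congr_of_eventuallyEq ?_
    filter_upwards [h.isOpen_base.mem_nhds ha] with b hb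
    exact (h.mem_of_mem_base b hb).2
  exact congrArg (fun (f : A →L[ℝ] A) => f v) (h1.unique h2)

lemma IsGraphOn.map_direction (h : IsGraphOn X P g U W) {y : EuclideanSpace ℝ (Fin n)}
    (hy : P y ∈ W) : P (direction P g y) = 0 := by
  rw [direction, map_smul, map_sub, (h.mem_of_mem_base _ hy).2, sub_self, smul_zero]

lemma IsGraphOn.contDiffAt_footHeight (h : IsGraphOn X P g U W) {y : EuclideanSpace ℝ (Fin n)}
    (hy : P y ∈ W) (hne : y ≠ g (P y)) : ContDiffAt ℝ 1 (footHeight P g) y := by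
  refine P.contDiff.contDiffAt.prodMk (ContDiffAt.norm ℝ ?_ (sub_ne_zero.2 hne))
  exact contDiffAt_id.sub ((h.contDiffAt hy).comp y P.contDiff.contDiffAt)

/-- The derivative `R` of `y - g (P y)` kills the range of `fderiv ℝ g (P y)` and fixes the
direction, along which the norm grows at unit speed. Hence the frame is an exact right inverse of
the derivative of `footHeight`, which is moreover bounded independently of the height. -/
lemma IsGraphOn.exists_hasFDerivAt_footHeight (h : IsGraphOn X P g U W)
    {y : EuclideanSpace ℝ (Fin n)} (hy : P y ∈ W) (hne : y ≠ g (P y)) :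
    ∃ D : EuclideanSpace ℝ (Fin n) →L[ℝ] A × ℝ, HasFDerivAt (footHeight P g) D y ∧
      (∀ b, D (frame P g y b) = b) ∧ ‖D‖ ≤ ‖P‖ + 1 + ‖fderiv ℝ g (P y)‖ * ‖P‖ := by
  set N := fderiv ℝ (norm : EuclideanSpace ℝ (Fin n) → ℝ) (y - g (P y)) with hN
  have hz : y - g (P y) ≠ 0 := sub_ne_zero.2 hne
  have hdn : DifferentiableAt ℝ (norm : EuclideanSpace ℝ (Fin n) → ℝ) (y - g (P y)) :=
    differentiableAt_id.norm ℝ hz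
  set R := ContinuousLinearMap.id ℝ (EuclideanSpace ℝ (Fin n)) - fderiv ℝ g (P y) ∘L P with hR
  have h1 : HasFDerivAt (fun y => y - g (P y)) R y :=
    (hasFDerivAt_id y).sub ((h.hasFDerivAt hy).comp y P.hasFDerivAt)
  have h2 : HasFDerivAt (fun y => ‖y - g (P y)‖) (N ∘L R) y :=
    HasFDerivAt.comp y hdn.hasFDerivAt h1
  have hN1 : ‖N‖ ≤ 1 := by
    simpa using norm_fderiv_le_of_lipschitz ℝ (x₀ := y - g (P y))
      (lipschitzWith_one_norm (E := EuclideanSpace ℝ (Fin n)))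
  have hRn : ‖R‖ ≤ 1 + ‖fderiv ℝ g (P y)‖ * ‖P‖ := by
    refine (norm_sub_le _ _).trans (add_le_add ContinuousLinearMap.norm_id_le ?_)
    exact ContinuousLinearMap.opNorm_comp_le _ _
  refine ⟨P.prod (N ∘L R), P.hasFDerivAt.prodMk h2, fun b => ?_, ?_⟩
  · have hPf : P (frame P g y b) = b.1 := by
      rw [frame_apply, map_add, h.map_fderiv hy, map_smul, h.map_direction hy]; simp
    have hRf : R (frame P g y b) = b.2 • direction P g y := by
      simp only [hR, _root_.sub_apply, ContinuousLinearMap.comp_apply, hPf]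
      simp
    refine Prod.ext hPf ?_
    change N (R (frame P g y b)) = b.2
    rw [hRf, direction, map_smul, map_smul, hN, hdn.fderiv_norm_self]
    simp [inv_mul_cancel₀ (norm_ne_zero_iff.2 hz)]
  · refine ContinuousLinearMap.opNorm_le_bound _ (by positivity) fun w => ?_
    rw [ContinuousLinearMap.prod_apply, Prod.norm_def]
    have a1 : ‖P w‖ ≤ ‖P‖ * ‖w‖ := P.le_opNorm w
    have a2 : ‖(N ∘L R) w‖ ≤ 1 * (1 + ‖fderiv ℝ g (P y)‖ * ‖P‖) * ‖w‖ := by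
      refine (ContinuousLinearMap.le_opNorm _ _).trans ?_
      gcongr
      exact (ContinuousLinearMap.opNorm_comp_le _ _).trans (by gcongr)
    have a3 : 0 ≤ ‖fderiv ℝ g (P y)‖ * ‖P‖ * ‖w‖ := by positivity
    have a4 : 0 ≤ ‖P‖ * ‖w‖ := by positivity
    have a5 := norm_nonneg w
    refine max_le ?_ ?_ <;> nlinarith

lemma IsGraphOn.eventually_near (h : IsGraphOn X P g U W) {x : EuclideanSpace ℝ (Fin n)}
    (hx : x ∈ X ∩ U) {r δ : ℝ} (hr : 0 < r) (hδ : 0 < δ) :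
    ∀ᶠ y in 𝓝 x, P y ∈ Metric.ball (P x) r ∧ ‖y - g (P y)‖ < δ := by
  obtain ⟨hxW, hgx⟩ := h.eq_of_mem x hx
  refine (P.continuous.continuousAt.eventually_mem (Metric.ball_mem_nhds _ hr)).and ?_
  have hc : ContinuousAt (fun y => ‖y - g (P y)‖) x :=
    (continuousAt_id.sub (ContinuousAt.comp (h.contDiffAt hxW).continuousAt
      P.continuous.continuousAt)).norm
  exact hc.eventually_lt_const (by simpa [hgx] using hδ)

/-- With `IsGraphOn.eventually_near` this says that the tubes over balls around `P x` form a basis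
of neighbourhoods of `x`, so that smallness can be measured by foot and height. -/
lemma IsGraphOn.exists_tube_subset (h : IsGraphOn X P g U W) {x : EuclideanSpace ℝ (Fin n)}
    (hx : x ∈ X ∩ U) {V : Set (EuclideanSpace ℝ (Fin n))} (hV : V ∈ 𝓝 x) :
    ∃ r > 0, ∃ δ > 0, Metric.closedBall (P x) r ⊆ W ∧
      ∀ y, P y ∈ Metric.closedBall (P x) r → ‖y - g (P y)‖ ≤ δ → y ∈ V := by
  obtain ⟨hxW, hgx⟩ := h.eq_of_mem x hx
  obtain ⟨ε, hε, hεV⟩ := Metric.mem_nhds_iff.1 hV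
  have h1 : ∀ᶠ a in 𝓝 (P x), a ∈ W ∧ dist (g a) x < ε / 2 := by
    refine (h.isOpen_base.eventually_mem hxW).and ?_
    have := Metric.tendsto_nhds.1 (h.contDiffAt hxW).continuousAt (ε / 2) (half_pos hε)
    rwa [hgx] at this
  obtain ⟨r, hr, hrW⟩ := Metric.nhds_basis_closedBall.eventually_iff.1 h1
  refine ⟨r, hr, ε / 3, by positivity, fun a ha => (hrW ha).1, fun y hy hyδ => hεV ?_⟩
  have h2 := (hrW hy).2
  have h3 := dist_triangle y (g (P y)) x
  rw [Metric.mem_ball]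
  rw [dist_eq_norm y (g (P y))] at h3
  linarith

/-- The estimate holds near each point of the graph. The graph over a closed ball is compact, so
some thickening of it lies in the open set where the estimate holds. -/
lemma IsGraphOn.exists_uniform_frame_approx [ProperSpace A] (h : IsGraphOn X P g U W)
    (hdisj : Disjoint X Y) (hb : ∀ x ∈ X, WhitneyBAt Y X x) {a₀ : A} {r : ℝ}
    (hr : Metric.closedBall a₀ r ⊆ W) {ε : ℝ} (hε : 0 < ε) :
    ∃ δ > 0, ∀ y ∈ Y, P y ∈ Metric.closedBall a₀ r → ‖y - g (P y)‖ < δ →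
      ∀ b, ∃ w ∈ tangentSpace Y y, ‖w - frame P g y b‖ ≤ ε * ‖b‖ := by
  set S := {y | y ∈ Y → ∀ b, ∃ w ∈ tangentSpace Y y, ‖w - frame P g y b‖ ≤ ε * ‖b‖} with hS
  have hK : IsCompact (g '' Metric.closedBall a₀ r) :=
    (isCompact_closedBall a₀ r).image_of_continuousOn (h.contDiffOn.continuousOn.mono hr)
  have hsub : g '' Metric.closedBall a₀ r ⊆ interior S := by
    rintro _ ⟨a, ha, rfl⟩
    have hm := (h.mem_of_mem_base a (hr ha)).1
    rw [mem_interior_iff_mem_nhds]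
    exact mem_nhdsWithin_iff_eventually.1
      (h.eventually_frame_approx hdisj hm (hb _ hm.1) hε)
  obtain ⟨δ, hδ, hδS⟩ := hK.exists_thickening_subset_open isOpen_interior hsub
  refine ⟨δ, hδ, fun y hy hya hyδ => interior_subset (hδS ?_) hy⟩
  rw [Metric.mem_thickening_iff]
  exact ⟨g (P y), mem_image_of_mem g hya, by rwa [dist_eq_norm]⟩

end Section

/-! ### The section of the foot-and-height map with values in `Y` -/

section Section

variable {n d : ℕ} {X Y U : Set (EuclideanSpace ℝ (Fin n))}
    {P : EuclideanSpace ℝ (Fin n) →L[ℝ] (Fin d → ℝ)} {g : (Fin d → ℝ) → EuclideanSpace ℝ (Fin n)}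
    {W : Set (Fin d → ℝ)}

/-- Near `x` the set `Y` is the image of a `C^1` section of `footHeight P g`, whose derivative is
asymptotic to the frame. -/
lemma IsGraphOn.exists_section (h : IsGraphOn X P g U W) (hY : IsSubmanifold 2 (d + 1) Y)
    (hdisj : Disjoint X Y) (hlc : IsLocallyClosed (X ∪ Y)) (hb : ∀ x ∈ X, WhitneyBAt Y X x)
    {x : EuclideanSpace ℝ (Fin n)} (hx : x ∈ X ∩ U) (hconn : ConnectedNear Y x) :
    ∃ r > 0, ∃ δ > 0, ∃ s : (Fin d → ℝ) × ℝ → EuclideanSpace ℝ (Fin n),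
      Metric.closedBall (P x) r ⊆ W ∧
      ContDiffOn ℝ 1 s (Metric.ball (P x) r ×ˢ Ioo 0 δ) ∧
      (∀ z ∈ Metric.ball (P x) r ×ˢ Ioo 0 δ, s z ∈ Y ∧ footHeight P g (s z) = z) ∧
      (∀ᶠ y in 𝓝 x, y ∈ Y → s (footHeight P g y) = y) ∧
      ∀ ε > 0, ∃ δ' > 0, ∀ z ∈ Metric.ball (P x) r ×ˢ Ioo 0 δ, z.2 < δ' →
        ‖fderiv ℝ s z - frame P g (s z)‖ ≤ ε := by
  obtain ⟨V, Z, hV, hZ, hVZ⟩ := hlc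
  have hxV : x ∈ V := by
    have : x ∈ X ∪ Y := Or.inl hx.1
    rw [hVZ] at this
    exact this.1
  -- Inside the tube, `U` identifies `X` with the graph, `V` makes `X ∪ Y` relatively closed, and
  -- the unit ball gives boundedness.
  obtain ⟨r, hr, δ₁, hδ₁, hrW, htube⟩ := h.exists_tube_subset hx
    (inter_mem (inter_mem (h.isOpen_source.mem_nhds hx.2) (hV.mem_nhds hxV))
      (Metric.ball_mem_nhds x one_pos))
  obtain ⟨K, hK⟩ : ∃ K, ∀ a ∈ Metric.closedBall (P x) r, ‖fderiv ℝ g a‖ ≤ K :=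
    (isCompact_closedBall (P x) r).exists_bound_of_continuousOn fun a ha =>
      (h.continuousAt_fderiv (hrW ha)).continuousWithinAt
  have hK0 : 0 ≤ K := (norm_nonneg _).trans (hK (P x) (Metric.mem_closedBall_self hr.le))
  -- A bound for the derivative of `footHeight` over the whole tube; `ε₀` is the accuracy at which
  -- that derivative is still injective on `T_yY`.
  set c := ‖P‖ + 1 + K * ‖P‖ with hc
  have hc0 : 0 < c := by positivity
  set ε₀ := 1 / (2 * c) with hε₀
  have hε₀0 : 0 < ε₀ := by positivity
  have hcε₀ : c * ε₀ ≤ 1 / 2 := by rw [hε₀]; field_simp; exact le_rfl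
  obtain ⟨δ₀, hδ₀, happrox⟩ := h.exists_uniform_frame_approx hdisj hb hrW hε₀0
  set δ := min δ₀ δ₁ with hδ
  have hδ0 : 0 < δ := lt_min hδ₀ hδ₁
  set O := Metric.ball (P x) r ×ˢ Ioo 0 δ with hO
  have hOo : IsOpen O := Metric.isOpen_ball.prod isOpen_Ioo
  have hOc : Convex ℝ O := (convex_ball _ _).prod (convex_Ioo _ _)
  have hmemW : ∀ y, footHeight P g y ∈ O → P y ∈ Metric.closedBall (P x) r :=
    fun y hy => Metric.ball_subset_closedBall hy.1
  have hne : ∀ y, footHeight P g y ∈ O → y ≠ g (P y) := by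
    intro y hy e
    have : 0 < ‖y - g (P y)‖ := hy.2.1
    rw [sub_eq_zero.2 e, norm_zero] at this
    exact lt_irrefl _ this
  have hfin : Module.finrank ℝ ((Fin d → ℝ) × ℝ) = d + 1 := by simp
  have hT : ∀ y ∈ Y, Module.finrank ℝ (tangentSpace Y y) ≤
      Module.finrank ℝ ((Fin d → ℝ) × ℝ) := fun y hy => by
    rw [hfin, hY.finrank_tangentSpace one_le_two hy]
  have hD : ∀ y ∈ Y, footHeight P g y ∈ O →
      ∃ D : EuclideanSpace ℝ (Fin n) →L[ℝ] (Fin d → ℝ) × ℝ, HasFDerivAt (footHeight P g) D y ∧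
      (∀ b, D (frame P g y b) = b) ∧ ‖D‖ ≤ c := by
    intro y hy hyO
    obtain ⟨D, h1, h2, h3⟩ := h.exists_hasFDerivAt_footHeight (hrW (hmemW y hyO)) (hne y hyO)
    refine ⟨D, h1, h2, h3.trans ?_⟩
    rw [hc]
    gcongr
    exact hK _ (hmemW y hyO)
  have hloc : ∀ y ∈ Y, footHeight P g y ∈ O → ∃ (U : Set (EuclideanSpace ℝ (Fin n)))
      (W : Set ((Fin d → ℝ) × ℝ)) (g' : (Fin d → ℝ) × ℝ → EuclideanSpace ℝ (Fin n)),
      IsOpen U ∧ y ∈ U ∧ IsOpen W ∧ ContDiffOn ℝ 1 g' W ∧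
      (∀ z ∈ W, g' z ∈ Y ∩ U ∧ footHeight P g (g' z) = z) ∧
      (∀ x ∈ Y ∩ U, footHeight P g x ∈ W ∧ g' (footHeight P g x) = x) := by
    intro y hy hyO
    obtain ⟨D, h1, h2, h3⟩ := hD y hy hyO
    refine hY.exists_section one_le_two hfin hy
      (h.contDiffAt_footHeight (hrW (hmemW y hyO)) (hne y hyO)) h1 ?_
    exact injOn_of_approx (hT y hy) h2 h3 hcε₀ (happrox y hy (hmemW y hyO)
      (hyO.2.2.trans_le (min_le_left _ _)))
  have hcont : ContinuousOn (footHeight P g) (P ⁻¹' Metric.closedBall (P x) r) := by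
    have h1 : ContinuousOn (fun y => g (P y)) (P ⁻¹' Metric.closedBall (P x) r) :=
      (h.contDiffOn.continuousOn.mono hrW).comp P.continuous.continuousOn fun y hy => hy
    exact P.continuous.continuousOn.prodMk (continuousOn_id.sub h1).norm
  -- Limits of points of `Y` in the tube lie in `X ∪ Y`, and points of `X` have height `0`, which
  -- does not occur in `K ⊆ O`.
  have hproper : ∀ K ⊆ O, IsCompact K → IsCompact (Y ∩ footHeight P g ⁻¹' K) := by
    intro K hKO hK
    have e : Y ∩ footHeight P g ⁻¹' K =
        Z ∩ (P ⁻¹' Metric.closedBall (P x) r ∩ footHeight P g ⁻¹' K) := by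
      ext y
      constructor
      · rintro ⟨hy, hyK⟩
        refine ⟨?_, hmemW y (hKO hyK), hyK⟩
        have : y ∈ X ∪ Y := Or.inr hy
        rw [hVZ] at this
        exact this.2
      · rintro ⟨hyZ, hyr, hyK⟩
        have hyO := hKO hyK
        have hyt := htube y hyr (hyO.2.2.le.trans (min_le_right _ _))
        have : y ∈ X ∪ Y := by rw [hVZ]; exact ⟨hyt.1.2, hyZ⟩
        rcases this with hyX | hyY
        · exact absurd (h.eq_of_mem y ⟨hyX, hyt.1.1⟩).2.symm (hne y hyO)
        · exact ⟨hyY, hyK⟩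
    refine Metric.isCompact_of_isClosed_isBounded ?_ ?_
    · rw [e]
      exact hZ.inter (hcont.preimage_isClosed_of_isClosed
        (Metric.isClosed_closedBall.preimage P.continuous) hK.isClosed)
    · refine (Metric.isBounded_ball (x := x) (r := 1)).subset ?_
      rintro y ⟨-, hyK⟩
      have hyO := hKO hyK
      exact (htube y (hmemW y hyO) (hyO.2.2.le.trans (min_le_right _ _))).2
  have hpos : ∀ y ∈ Y, P y ∈ W → 0 < ‖y - g (P y)‖ := by
    intro y hy hyW
    refine norm_pos_iff.2 (sub_ne_zero.2 fun e => ?_)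
    exact Set.disjoint_left.1 hdisj (h.mem_of_mem_base _ hyW).1.1 (e ▸ hy)
  obtain ⟨ε₁, hε₁, hball⟩ := Metric.mem_nhds_iff.1 (h.eventually_near hx hr hδ0)
  have hconn' : ∀ᶠ ε in 𝓝[>] (0 : ℝ), ε < ε₁ ∧ 0 < ε :=
    Eventually.and (nhdsWithin_le_nhds (Iio_mem_nhds hε₁)) self_mem_nhdsWithin
  obtain ⟨ε, hεc, hεε₁, hε⟩ := (hconn.and hconn').exists
  -- This connected piece of `Y` lies over `O`, so the section through any one of its points
  -- contains all of it: only one sheet reaches `x`.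
  have hC : Y ∩ Metric.ball x ε ⊆ Y ∩ footHeight P g ⁻¹' O := by
    rintro y ⟨hy, hyb⟩
    have h1 := hball (Metric.ball_subset_ball hεε₁.le hyb)
    exact ⟨hy, h1.1, hpos y hy (hrW (Metric.ball_subset_closedBall h1.1)), h1.2⟩
  obtain ⟨y₀, hy₀⟩ := hεc.nonempty
  obtain ⟨s, hsc, hs, hsC⟩ := exists_global_section hOo hOc
    (hcont.mono fun y hy => hmemW y hy.2) hproper
    (fun y hy hyO => by
      obtain ⟨U, W, g', h1, h2, h3, h4, h5⟩ := hloc y hy hyO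
      exact ⟨U, W, g', h1, h2, h3, h4.continuousOn, h5⟩) hy₀.1 (hC hy₀).2
  have hsd : ContDiffOn ℝ 1 s O := by
    intro z hz
    refine ContDiffAt.contDiffWithinAt ?_
    obtain ⟨U, W, g', h1, h2, h3, h4, h5, h6⟩ := hloc (s z) (hs z hz).1 (by rwa [(hs z hz).2])
    have hzW : z ∈ W := by
      have := (h6 _ ⟨(hs z hz).1, h2⟩).1
      rwa [(hs z hz).2] at this
    refine (h4.contDiffAt (h3.mem_nhds hzW)).congr_of_eventuallyEq ?_
    filter_upwards [(hsc.continuousAt (hOo.mem_nhds hz)).eventually_mem (h1.mem_nhds h2),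
      hOo.mem_nhds hz] with z' hz' hz'O
    have := (h6 _ ⟨(hs z' hz'O).1, hz'⟩).2
    rw [(hs z' hz'O).2] at this
    exact this.symm
  refine ⟨r, hr, δ, hδ0, s, hrW, hsd, hs, ?_, ?_⟩
  · filter_upwards [Metric.ball_mem_nhds x hε] with y hyb hy
    exact hsC _ hC hεc.isPreconnected hy₀ y ⟨hy, hyb⟩
  · intro ε hε
    -- The first entry keeps `c * ε' ≤ 1 / 2`; the second makes the bound of `norm_sub_le_of_approx`
    -- at most `ε`, as the frame has norm at most `K + 1`.
    set ε' := min ε₀ (ε / (2 + 2 * c * (K + 1))) with hε'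
    have hε'0 : 0 < ε' := lt_min hε₀0 (by positivity)
    obtain ⟨δ', hδ', happ⟩ := h.exists_uniform_frame_approx hdisj hb hrW hε'0
    refine ⟨δ', hδ', fun z hz hzδ => ?_⟩
    obtain ⟨hsY, hsz⟩ := hs z hz
    have hszO : footHeight P g (s z) ∈ O := by rwa [hsz]
    obtain ⟨D, h1, h2, h3⟩ := hD (s z) hsY hszO
    have hsdz : HasFDerivAt s (fderiv ℝ s z) z :=
      ((hsd.contDiffAt (hOo.mem_nhds hz)).differentiableAt one_ne_zero).hasFDerivAt
    have hDS : ∀ b, D (fderiv ℝ s z b) = b := by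
      intro b
      have h4 : HasFDerivAt (footHeight P g ∘ s) (ContinuousLinearMap.id ℝ _) z := by
        refine (hasFDerivAt_id z).congr_of_eventuallyEq ?_
        filter_upwards [hOo.mem_nhds hz] with z' hz'
        exact (hs z' hz').2
      exact congrArg (fun (f : _ →L[ℝ] _) => f b) ((h1.comp z hsdz).unique h4)
    have hS : ∀ b, fderiv ℝ s z b ∈ tangentSpace Y (s z) := by
      refine fun b => WhitneyPawlucki.fderiv_mem_tangentSpace hsdz ?_ b
      filter_upwards [hOo.mem_nhds hz] with z' hz'
      exact (hs z' hz').1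
    have hzδ' : ‖s z - g (P (s z))‖ < δ' := by
      have : ‖s z - g (P (s z))‖ = z.2 := congrArg Prod.snd hsz
      rwa [this]
    refine (norm_sub_le_of_approx (hT _ hsY) h2 h3 hε'0.le
      ((mul_le_mul_of_nonneg_left (min_le_left _ _) hc0.le).trans hcε₀)
      (happ _ hsY (hmemW _ hszO) hzδ') hS hDS).trans ?_
    have hΛ : ‖frame P g (s z)‖ ≤ K + 1 :=
      (norm_frame_le P g _).trans (by gcongr; exact hK _ (hmemW _ hszO))
    calc ε' * (2 + 2 * c * ‖frame P g (s z)‖) ≤ ε' * (2 + 2 * c * (K + 1)) := by gcongr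
      _ ≤ ε := by
        have : ε' ≤ ε / (2 + 2 * c * (K + 1)) := min_le_right _ _
        rwa [le_div_iff₀ (by positivity)] at this

end Section

/-! ### Convergence from a power bound on dyadic oscillation -/

section Limit

variable {A E : Type*} [NormedAddCommGroup E]

/-- A function of `t > 0` whose dyadic oscillation is bounded by a power of `t` converges as `t`
tends to `0`, uniformly in parameters. -/
lemma exists_uniform_limit [CompleteSpace E] {u : A × ℝ → E} {S : Set A} {N : ℕ} {t₁ : ℝ}
    (ht₁ : 0 < t₁)
    (h : ∀ a ∈ S, ∀ t t', 0 < t' → t' ≤ t → t ≤ 2 * t' → t < t₁ →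
      ‖u (a, t) - u (a, t')‖ ^ (N + 1) ≤ t) :
    ∃ u₀ : A → E, ∀ ε > 0, ∃ δ > 0, ∀ a ∈ S, ∀ t, 0 < t → t < δ → ‖u (a, t) - u₀ a‖ ≤ ε := by
  set θ : ℝ := ((N + 1 : ℕ) : ℝ)⁻¹ with hθ
  have hθ0 : 0 < θ := by positivity
  have h1 : ∀ a ∈ S, ∀ t t', 0 < t' → t' ≤ t → t ≤ 2 * t' → t < t₁ →
      ‖u (a, t) - u (a, t')‖ ≤ t ^ θ := by
    intro a ha t t' ht' htt h2t ht
    have := Real.rpow_le_rpow (by positivity) (h a ha t t' ht' htt h2t ht) hθ0.le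
    rwa [Real.pow_rpow_inv_natCast (norm_nonneg _) (Nat.succ_ne_zero N)] at this
  set q : ℝ := (1 / 2 : ℝ) ^ θ with hq
  have hq1 : q < 1 := Real.rpow_lt_one (by norm_num) (by norm_num) hθ0
  have hq0 : 0 ≤ q := by positivity
  -- The sum of the geometric series of ratio `q`, by which `t ^ θ` shrinks when `t` is halved; `1 +
  -- q * c = c` drives the induction on the number of halvings.
  set c : ℝ := 1 / (1 - q) with hc
  have hc1 : 1 + q * c = c := by
    have : 1 - q ≠ 0 := by linarith
    rw [hc]; field_simp; ring
  have hc0 : 0 < c := by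
    have : 0 < 1 - q := by linarith
    positivity
  have h2 : ∀ a ∈ S, ∀ k : ℕ, ∀ t t', 0 < t' → t' ≤ t → t ≤ 2 ^ k * t' → t < t₁ →
      ‖u (a, t) - u (a, t')‖ ≤ c * t ^ θ := by
    intro a ha k
    induction k with
    | zero =>
      intro t t' ht' htt hk ht
      have : t = t' := le_antisymm (by simpa using hk) htt
      subst this
      have : 0 ≤ t ^ θ := by positivity
      simp only [sub_self, norm_zero]
      positivity
    | succ k ih =>
      intro t t' ht' htt hk ht
      have ht0 : 0 < t := ht'.trans_le htt
      have hpow : 0 ≤ t ^ θ := by positivity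
      rcases le_or_gt t (2 * t') with h2t | h2t
      · refine (h1 a ha t t' ht' htt h2t ht).trans ?_
        have : 1 ≤ c := by nlinarith
        nlinarith
      · have e1 := h1 a ha t (t / 2) (by positivity) (by linarith) (by linarith) ht
        have e2 := ih (t / 2) t' ht' (by linarith)
          (by rw [pow_succ] at hk; linarith) (by linarith)
        have e3 : (t / 2) ^ θ = q * t ^ θ := by
          rw [hq, ← Real.mul_rpow (by norm_num) ht0.le]; ring_nf
        calc ‖u (a, t) - u (a, t')‖ ≤ ‖u (a, t) - u (a, t / 2)‖ + ‖u (a, t / 2) - u (a, t')‖ :=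
              norm_sub_le_norm_sub_add_norm_sub _ _ _
          _ ≤ t ^ θ + c * (q * t ^ θ) := by rw [← e3]; exact add_le_add e1 e2
          _ = (1 + q * c) * t ^ θ := by ring
          _ = c * t ^ θ := by rw [hc1]
  have h3 : ∀ a ∈ S, ∀ t t', 0 < t' → t' ≤ t → t < t₁ →
      ‖u (a, t) - u (a, t')‖ ≤ c * t ^ θ := by
    intro a ha t t' ht' htt ht
    obtain ⟨k, hk⟩ := pow_unbounded_of_one_lt (t / t') (one_lt_two : (1 : ℝ) < 2)
    refine h2 a ha k t t' ht' htt ?_ ht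
    rw [div_lt_iff₀ ht'] at hk
    exact hk.le
  have hlim : Tendsto (fun t : ℝ => c * t ^ θ) (𝓝[>] 0) (𝓝 0) := by
    have : ContinuousAt (fun t : ℝ => c * t ^ θ) 0 :=
      continuousAt_const.mul (Real.continuousAt_rpow_const _ _ (Or.inr hθ0.le))
    have h4 := this.tendsto
    rw [Real.zero_rpow hθ0.ne', mul_zero] at h4
    exact h4.mono_left nhdsWithin_le_nhds
  have hsmall : ∀ ε > 0, ∃ δ > 0, δ ≤ t₁ ∧ ∀ t, 0 < t → t < δ → c * t ^ θ < ε := by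
    intro ε hε
    obtain ⟨δ, hδ, hδ'⟩ := mem_nhdsGT_iff_exists_Ioo_subset.1 (hlim.eventually_lt_const hε)
    exact ⟨min δ t₁, lt_min hδ ht₁, min_le_right _ _,
      fun t h0 ht => hδ' ⟨h0, ht.trans_le (min_le_left _ _)⟩⟩
  have hex : ∀ a ∈ S, ∃ l, Tendsto (fun t => u (a, t)) (𝓝[>] 0) (𝓝 l) := by
    intro a ha
    rw [← cauchy_map_iff_exists_tendsto, Metric.cauchy_iff]
    refine ⟨inferInstance, fun ε hε => ?_⟩
    obtain ⟨δ, hδ, hδ₁, hδε⟩ := hsmall ε hε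
    refine ⟨(fun t => u (a, t)) '' Ioo 0 δ, image_mem_map (Ioo_mem_nhdsGT hδ), ?_⟩
    rintro _ ⟨t, ht, rfl⟩ _ ⟨t', ht', rfl⟩
    rw [dist_eq_norm]
    rcases le_total t' t with hle | hle
    · exact (h3 a ha t t' ht'.1 hle (ht.2.trans_le hδ₁)).trans_lt (hδε t ht.1 ht.2)
    · rw [norm_sub_rev]
      exact (h3 a ha t' t ht.1 hle (ht'.2.trans_le hδ₁)).trans_lt (hδε t' ht'.1 ht'.2)
  choose! u₀ hu₀ using hex
  refine ⟨u₀, fun ε hε => ?_⟩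
  obtain ⟨δ, hδ, hδ₁, hδε⟩ := hsmall ε hε
  refine ⟨δ, hδ, fun a ha t h0 ht => ?_⟩
  -- Letting `t' → 0` in the Cauchy estimate, which does not depend on `a`, gives the uniform rate.
  have h5 : Tendsto (fun t' => ‖u (a, t) - u (a, t')‖) (𝓝[>] 0) (𝓝 ‖u (a, t) - u₀ a‖) :=
    ((hu₀ a ha).const_sub _).norm
  refine le_of_tendsto h5 ?_
  filter_upwards [Ioo_mem_nhdsGT h0] with t' ht'
  exact (h3 a ha t t' ht'.1 ht'.2.le (ht.trans_le hδ₁)).trans (hδε t h0 ht).le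

end Limit

/-! ### Oscillation of the direction along the section -/

section Oscillation

variable {n d : ℕ} {X Y U : Set (EuclideanSpace ℝ (Fin n))}
    {P : EuclideanSpace ℝ (Fin n) →L[ℝ] (Fin d → ℝ)} {g : (Fin d → ℝ) → EuclideanSpace ℝ (Fin n)}
    {W : Set (Fin d → ℝ)} {s : (Fin d → ℝ) × ℝ → EuclideanSpace ℝ (Fin n)} {a₀ : Fin d → ℝ}
    {r δ : ℝ}

lemma direction_eq_of_footHeight_eq {y : EuclideanSpace ℝ (Fin n)} {z : (Fin d → ℝ) × ℝ}
    (h : footHeight P g y = z) : direction P g y = z.2⁻¹ • (y - g z.1) := by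
  subst h
  rfl

lemma norm_direction_of_footHeight_eq {y : EuclideanSpace ℝ (Fin n)} {z : (Fin d → ℝ) × ℝ}
    (h : footHeight P g y = z) (hz : 0 < z.2) : ‖direction P g y‖ = 1 := by
  subst h
  have : ‖y - g (P y)‖ ≠ 0 := hz.ne'
  rw [direction, norm_smul, norm_inv, norm_norm, inv_mul_cancel₀ this]

/-- The `τ`-derivative of `τ⁻¹ • (s (a, τ) - g a)` is `τ⁻¹` times the value at `(0, 1)` of the
difference between the derivative of `s` and the frame. It is at most `ε / t'` on `[t', t]`, an
interval of length at most `t'`. -/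
lemma direction_oscillation_small
    (hsd : ContDiffOn ℝ 1 s (Metric.ball a₀ r ×ˢ Ioo 0 δ))
    (hs : ∀ z ∈ Metric.ball a₀ r ×ˢ Ioo 0 δ, s z ∈ Y ∧ footHeight P g (s z) = z)
    (hest : ∀ ε > 0, ∃ δ' > 0, ∀ z ∈ Metric.ball a₀ r ×ˢ Ioo 0 δ, z.2 < δ' →
        ‖fderiv ℝ s z - frame P g (s z)‖ ≤ ε) {ε : ℝ} (hε : 0 < ε) :
    ∃ δ' > 0, ∀ a ∈ Metric.ball a₀ r, ∀ t t', 0 < t' → t' ≤ t → t ≤ 2 * t' → t < δ → t < δ' →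
      ‖direction P g (s (a, t)) - direction P g (s (a, t'))‖ ≤ ε := by
  obtain ⟨δ', hδ', hest⟩ := hest ε hε
  refine ⟨δ', hδ', fun a ha t t' ht' htt h2t htδ htδ' => ?_⟩
  have hOo : IsOpen (Metric.ball a₀ r ×ˢ Ioo 0 δ) := Metric.isOpen_ball.prod isOpen_Ioo
  have hmem : ∀ τ ∈ Icc t' t, (a, τ) ∈ Metric.ball a₀ r ×ˢ Ioo 0 δ := fun τ hτ =>
    ⟨ha, ht'.trans_le hτ.1, hτ.2.trans_lt htδ⟩
  have hdir : ∀ τ ∈ Icc t' t, direction P g (s (a, τ)) = τ⁻¹ • (s (a, τ) - g a) := fun τ hτ =>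
    direction_eq_of_footHeight_eq (hs _ (hmem τ hτ)).2
  have hderiv : ∀ τ ∈ Icc t' t, HasDerivWithinAt (fun τ => τ⁻¹ • (s (a, τ) - g a))
      (τ⁻¹ • (fderiv ℝ s (a, τ) - frame P g (s (a, τ))) (0, 1)) (Icc t' t) τ := by
    intro τ hτ
    have hτ0 : τ ≠ 0 := (ht'.trans_le hτ.1).ne'
    have h1 : HasFDerivAt s (fderiv ℝ s (a, τ)) (a, τ) := ((hsd.contDiffAt
      (hOo.mem_nhds (hmem τ hτ))).differentiableAt one_ne_zero).hasFDerivAt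
    have h2 : HasDerivAt (fun τ : ℝ => (a, τ)) ((0 : Fin d → ℝ), (1 : ℝ)) τ :=
      (hasDerivAt_const τ a).prodMk (hasDerivAt_id τ)
    have h3 : HasDerivAt (fun τ => s (a, τ) - g a) (fderiv ℝ s (a, τ) (0, 1)) τ :=
      (h1.comp_hasDerivAt τ h2).sub_const _
    have h4 := (hasDerivAt_inv hτ0).smul h3
    refine (h4.congr_deriv ?_).hasDerivWithinAt
    rw [_root_.sub_apply, frame_apply, hdir τ hτ, map_zero, zero_add, one_smul]
    have : (τ ^ 2)⁻¹ = τ⁻¹ * τ⁻¹ := by rw [sq, mul_inv]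
    rw [this]
    module
  have hbound : ∀ τ ∈ Icc t' t,
      ‖τ⁻¹ • (fderiv ℝ s (a, τ) - frame P g (s (a, τ))) (0, 1)‖ ≤ t'⁻¹ * ε := by
    intro τ hτ
    rw [norm_smul, norm_inv, Real.norm_of_nonneg (ht'.trans_le hτ.1).le]
    have h1 : ‖(fderiv ℝ s (a, τ) - frame P g (s (a, τ))) ((0 : Fin d → ℝ), (1 : ℝ))‖ ≤ ε := by
      refine (ContinuousLinearMap.le_opNorm _ _).trans ?_
      have : ‖((0 : Fin d → ℝ), (1 : ℝ))‖ = 1 := by simp [Prod.norm_def]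
      rw [this, mul_one]
      exact hest _ (hmem τ hτ) (hτ.2.trans_lt htδ')
    have h2 : τ⁻¹ ≤ t'⁻¹ := inv_anti₀ ht' hτ.1
    gcongr
  have := (convex_Icc t' t).norm_image_sub_le_of_norm_hasDerivWithin_le hderiv hbound
    (left_mem_Icc.2 htt) (right_mem_Icc.2 htt)
  rw [hdir t (right_mem_Icc.2 htt), hdir t' (left_mem_Icc.2 htt)]
  refine this.trans ?_
  rw [Real.norm_of_nonneg (sub_nonneg.2 htt), mul_comm t'⁻¹, mul_assoc]
  have : t'⁻¹ * (t - t') ≤ 1 := by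
    rw [inv_mul_le_iff₀ ht']; linarith
  nlinarith

variable {L : Language} [L.Structure ℝ]

/-- Neither `s` nor `g` is assumed definable, so the oscillation is encoded by
`DirectionOscillation`, which mentions only `X`, `Y` and linear data. The encoding is faithful near
`x`, where all of `Y` lies on the section, and polynomial boundedness then improves `o(1)` to a
power. -/
lemma IsGraphOn.direction_oscillation_le_pow (hL : IsOMinimal L) (hpb : IsPolynomiallyBounded L)
    (hX : IsDefinable L X) (hY : IsDefinable L Y) (h : IsGraphOn X P g U W)
    {x : EuclideanSpace ℝ (Fin n)} (hx : x ∈ X ∩ U) (hr : 0 < r) (hδ : 0 < δ)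
    (hrW : Metric.closedBall (P x) r ⊆ W)
    (hsd : ContDiffOn ℝ 1 s (Metric.ball (P x) r ×ˢ Ioo 0 δ))
    (hs : ∀ z ∈ Metric.ball (P x) r ×ˢ Ioo 0 δ, s z ∈ Y ∧ footHeight P g (s z) = z)
    (hsY : ∀ᶠ y in 𝓝 x, y ∈ Y → s (footHeight P g y) = y)
    (hest : ∀ ε > 0, ∃ δ' > 0, ∀ z ∈ Metric.ball (P x) r ×ˢ Ioo 0 δ, z.2 < δ' →
        ‖fderiv ℝ s z - frame P g (s z)‖ ≤ ε) :
    ∃ N : ℕ, ∃ t₁ > 0, ∃ r' > 0, r' ≤ r ∧ ∀ a ∈ Metric.ball (P x) r', ∀ t t', 0 < t' → t' ≤ t →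
      t ≤ 2 * t' → t < t₁ →
      ‖direction P g (s (a, t)) - direction P g (s (a, t'))‖ ^ (N + 1) ≤ t := by
  obtain ⟨r₁, hr₁, δ₁, hδ₁, hr₁W, htube⟩ := h.exists_tube_subset hx hsY
  obtain ⟨hxW, hgx⟩ := h.eq_of_mem x hx
  obtain ⟨η, hη, hηb⟩ := Metric.mem_nhds_iff.1 ((P.continuous.continuousAt.eventually_mem
    (Metric.ball_mem_nhds (P x) (lt_min hr hr₁))).and (h.isOpen_source.eventually_mem hx.2))
  -- A point `p + t • u` of `Y` as in the relation has foot `p` and height `t`, so it is `s (P p,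
  -- t)` and `u` is its direction.
  have hpoint : ∀ (p u : EuclideanSpace ℝ (Fin n)) (t : ℝ), p ∈ X → ‖p - x‖ ^ 2 < η ^ 2 →
      ‖u‖ ^ 2 = 1 → P u = 0 → p + t • u ∈ Y → 0 < t → t < min δ δ₁ →
      P p ∈ Metric.ball (P x) r ∧ direction P g (s (P p, t)) = u := by
    intro p u t hp hpη hu hPu hY ht0 htδ
    have hpb : p ∈ Metric.ball x η := by
      rw [Metric.mem_ball, dist_eq_norm]
      exact lt_of_pow_lt_pow_left₀ 2 hη.le hpη
    obtain ⟨h1, h2⟩ := hηb hpb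
    have hgp := (h.eq_of_mem p ⟨hp, h2⟩).2
    have hPy : P (p + t • u) = P p := by simp [hPu]
    have hu1 : ‖u‖ = 1 := by
      have := norm_nonneg u
      nlinarith
    have hyg : p + t • u - g (P (p + t • u)) = t • u := by rw [hPy, hgp]; abel
    have hht : ‖p + t • u - g (P (p + t • u))‖ = t := by
      rw [hyg, norm_smul, hu1, Real.norm_of_nonneg ht0.le, mul_one]
    have hfh : footHeight P g (p + t • u) = (P p, t) := Prod.ext hPy hht
    have hsy := htube (p + t • u) (by
      rw [hPy]
      exact Metric.ball_subset_closedBall (Metric.ball_subset_ball (min_le_right _ _) h1))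
      (by rw [hht]; exact (htδ.trans_le (min_le_right _ _)).le) hY
    rw [hfh] at hsy
    refine ⟨Metric.ball_subset_ball (min_le_left _ _) h1, ?_⟩
    rw [hsy, direction, hht, hyg, smul_smul, inv_mul_cancel₀ ht0.ne', one_smul]
  obtain ⟨N, σ₀, hσ₀, hN⟩ := hpb.exists_pow_le hL
    (definable_directionOscillation hL hX hY P x η (min δ δ₁)) (by
      intro σ hσ
      obtain ⟨δ', hδ', hosc⟩ := direction_oscillation_small hsd hs hest (half_pos hσ)
      refine ⟨δ', hδ', fun t ht => ?_⟩
      obtain ⟨-, ht0, htδ, p, u, u', t', hp, hpη, hu, hu', hPu, hPu', hpY, hpY', h2t, htt, hσu⟩ :=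
        ht
      by_contra! hlt
      have ht'0 : 0 < t' := by linarith
      obtain ⟨ha, e⟩ := hpoint p u t hp hpη hu hPu hpY ht0 htδ
      obtain ⟨-, e'⟩ := hpoint p u' t' hp hpη hu' hPu' hpY' ht'0 (htt.trans_lt htδ)
      have h3 := hosc _ ha t t' ht'0 htt h2t (htδ.trans_le (min_le_left _ _)) hlt
      rw [e, e'] at h3
      have h4 := norm_nonneg (u - u')
      nlinarith)
  -- At accuracy `min σ₀ 1 / 2` the oscillation `σ` is below `σ₀`, where the power bound applies,
  -- and below `1`, so that `σ ^ (N + 1) ≤ σ ^ N`. The exponent `N + 1` also covers `σ = 0`, which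
  -- the relation excludes.
  obtain ⟨δ', hδ', hosc⟩ := direction_oscillation_small hsd hs hest
    (half_pos (lt_min hσ₀ one_pos))
  have hg : ∀ᶠ a in 𝓝 (P x), ‖g a - x‖ < η := by
    have := Metric.tendsto_nhds.1 (h.contDiffAt hxW).continuousAt η hη
    simpa [hgx, dist_eq_norm] using this
  obtain ⟨r₂, hr₂, hr₂g⟩ := Metric.eventually_nhds_iff_ball.1 hg
  refine ⟨N, min δ' (min δ δ₁), lt_min hδ' (lt_min hδ hδ₁), min r r₂, lt_min hr hr₂,
    min_le_left _ _, fun a ha t t' ht' htt h2t ht => ?_⟩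
  have har : a ∈ Metric.ball (P x) r := Metric.ball_subset_ball (min_le_left _ _) ha
  have haW := hrW (Metric.ball_subset_closedBall har)
  have ht0 : 0 < t := ht'.trans_le htt
  have htm : t < min δ δ₁ := ht.trans_le (min_le_right _ _)
  have htδ : t < δ := htm.trans_le (min_le_left _ _)
  set σ := ‖direction P g (s (a, t)) - direction P g (s (a, t'))‖ with hσ
  have hσnn : 0 ≤ σ := norm_nonneg _
  rcases hσnn.eq_or_lt with h0 | h0
  · rw [← h0, zero_pow (Nat.succ_ne_zero N)]; exact ht0.le
  have hσ1 : σ ≤ min σ₀ 1 / 2 := hosc a har t t' ht' htt h2t htδ (ht.trans_le (min_le_left _ _))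
  have hmin : 0 < min σ₀ 1 := lt_min hσ₀ one_pos
  have hσσ₀ : σ < σ₀ := by
    have := min_le_left σ₀ 1
    linarith
  have hσle : σ ≤ 1 := by
    have := min_le_right σ₀ 1
    linarith
  have hsec : ∀ τ, 0 < τ → τ < δ → ‖direction P g (s (a, τ))‖ ^ 2 = 1 ∧
      P (direction P g (s (a, τ))) = 0 ∧ g a + τ • direction P g (s (a, τ)) ∈ Y := by
    intro τ hτ hτδ
    obtain ⟨h1, h2⟩ := hs (a, τ) ⟨har, hτ, hτδ⟩
    have h3 : P (s (a, τ)) = a := congrArg Prod.fst h2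
    refine ⟨by rw [norm_direction_of_footHeight_eq h2 hτ, one_pow],
      h.map_direction (by rwa [h3]), ?_⟩
    rw [direction_eq_of_footHeight_eq h2, smul_smul, mul_inv_cancel₀ hτ.ne', one_smul,
      add_sub_cancel]
    exact h1
  obtain ⟨b1, b2, b3⟩ := hsec t ht0 htδ
  obtain ⟨c1, c2, c3⟩ := hsec t' ht' (htt.trans_lt htδ)
  have hosc' : DirectionOscillation X Y P x η (min δ δ₁) σ t :=
    ⟨h0, ht0, htm, g a, _, _, t', (h.mem_of_mem_base a haW).1.1, by
      have := hr₂g a (Metric.ball_subset_ball (min_le_right _ _) ha)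
      gcongr, b1, c1, b2, c2, b3, c3, h2t, htt, by rw [← hσ, sq]⟩
  calc σ ^ (N + 1) ≤ σ ^ N := pow_le_pow_of_le_one h0.le hσle (Nat.le_succ N)
    _ ≤ t := hN σ t h0 hσσ₀ hosc'

end Oscillation

/-! ### `C^1` extension across the edge by odd reflection -/

section Reflection

variable {A E : Type*} [NormedAddCommGroup A] [NormedSpace ℝ A] [NormedAddCommGroup E]
  [NormedSpace ℝ E]

/-- The odd reflection of `s` in the graph of `g`. -/
def oddExtension (g : A → E) (s : A × ℝ → E) (z : A × ℝ) : E :=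
  if 0 < z.2 then s z else if z.2 = 0 then g z.1 else (2 : ℝ) • g z.1 - s (z.1, -z.2)

/-- The candidate derivative of `g a + t • u a` at `t = 0`. -/
def edgeDeriv (g : A → E) (u : A → E) (a : A) : A × ℝ →L[ℝ] E :=
  (fderiv ℝ g a).coprod (ContinuousLinearMap.toSpanSingleton ℝ (u a))

lemma edgeDeriv_apply (g : A → E) (u : A → E) (a : A) (b : A × ℝ) :
    edgeDeriv g u a b = fderiv ℝ g a b.1 + b.2 • u a := by
  simp [edgeDeriv]

/-- The reflection `(a, t) ↦ (a, -t)`. -/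
def flipSnd : A × ℝ →L[ℝ] A × ℝ :=
  (ContinuousLinearMap.fst ℝ A ℝ).prod (-ContinuousLinearMap.snd ℝ A ℝ)

@[simp] lemma flipSnd_apply (z : A × ℝ) : flipSnd z = (z.1, -z.2) := rfl

lemma norm_flipSnd_le : ‖(flipSnd : A × ℝ →L[ℝ] A × ℝ)‖ ≤ 1 :=
  ContinuousLinearMap.opNorm_le_bound _ zero_le_one fun z => by
    rw [one_mul, flipSnd_apply, Prod.norm_def, Prod.norm_def]; simp

variable {S : Set A} {δ : ℝ} {g : A → E} {s : A × ℝ → E} {u : A → E}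

lemma hasFDerivAt_oddExtension_of_pos {z : A × ℝ} (hz : 0 < z.2) (hs : DifferentiableAt ℝ s z) :
    HasFDerivAt (oddExtension g s) (fderiv ℝ s z) z := by
  refine hs.hasFDerivAt.congr_of_eventuallyEq ?_
  filter_upwards [continuous_snd.continuousAt.eventually (lt_mem_nhds hz)] with w hw
  have hw' : 0 < w.2 := hw
  simp [oddExtension, hw']

lemma hasFDerivAt_oddExtension_of_neg {z : A × ℝ} (hz : z.2 < 0)
    (hs : DifferentiableAt ℝ s (flipSnd z)) (hg : DifferentiableAt ℝ g z.1) :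
    HasFDerivAt (oddExtension g s) ((2 : ℝ) • (fderiv ℝ g z.1 ∘L ContinuousLinearMap.fst ℝ A ℝ) -
      fderiv ℝ s (flipSnd z) ∘L flipSnd) z := by
  have hf : HasFDerivAt (fun w : A × ℝ => flipSnd w) (flipSnd : A × ℝ →L[ℝ] A × ℝ) z :=
    ContinuousLinearMap.hasFDerivAt _
  have h1 : HasFDerivAt (fun w : A × ℝ => (2 : ℝ) • g w.1 - s (flipSnd w))
      ((2 : ℝ) • (fderiv ℝ g z.1 ∘L ContinuousLinearMap.fst ℝ A ℝ) -
        fderiv ℝ s (flipSnd z) ∘L flipSnd) z :=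
    ((hg.hasFDerivAt.comp z hasFDerivAt_fst).const_smul (2 : ℝ)).sub
      (hs.hasFDerivAt.comp z hf)
  refine h1.congr_of_eventuallyEq ?_
  filter_upwards [continuous_snd.continuousAt.eventually (gt_mem_nhds hz)] with w hw
  have hw' : w.2 < 0 := hw
  simp [oddExtension, hw'.not_gt, hw'.ne]

/-- After `g` is subtracted the extension is odd in the height, so the one-sided expansion `z.2 • u
z.1` holds on both sides. Continuity of `u` suffices to replace `u z.1` by `u a`, the error being
multiplied by `z.2`. -/
lemma hasFDerivAt_oddExtension_of_eq_zero (hS : IsOpen S) (hδ : 0 < δ)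
    (hu : ContinuousOn u S)
    (hval : ∀ ε > 0, ∃ δ' > 0, ∀ z ∈ S ×ˢ Ioo 0 δ, z.2 < δ' →
      ‖s z - g z.1 - z.2 • u z.1‖ ≤ ε * z.2) {a : A} (ha : a ∈ S) (hg : DifferentiableAt ℝ g a) :
    HasFDerivAt (oddExtension g s) (edgeDeriv g u a) (a, 0) := by
  have h1 : HasFDerivAt (fun z => oddExtension g s z - g z.1)
      (ContinuousLinearMap.toSpanSingleton ℝ (u a) ∘L ContinuousLinearMap.snd ℝ A ℝ) (a, 0) := by
    rw [hasFDerivAt_iff_isLittleO, Asymptotics.isLittleO_iff]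
    intro ε hε
    obtain ⟨δ', hδ', hv⟩ := hval (ε / 2) (half_pos hε)
    have e1 : ∀ᶠ z : A × ℝ in 𝓝 (a, 0), z.1 ∈ S ∧ ‖u z.1 - u a‖ < ε / 2 := by
      refine continuous_fst.continuousAt.eventually
        (p := fun b => b ∈ S ∧ ‖u b - u a‖ < ε / 2) ?_
      refine (hS.eventually_mem ha).and ?_
      have := Metric.tendsto_nhds.1 (hu.continuousAt (hS.mem_nhds ha)) (ε / 2) (half_pos hε)
      simpa [dist_eq_norm] using this
    have e2 : ∀ᶠ z : A × ℝ in 𝓝 (a, 0), |z.2| < min δ δ' := by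
      have : ContinuousAt (fun z : A × ℝ => |z.2|) (a, 0) := by fun_prop
      exact this.eventually_lt_const (by simpa using ⟨hδ, hδ'⟩)
    filter_upwards [e1, e2] with z hz1 hz2
    have hodd : ‖oddExtension g s z - g z.1 - z.2 • u z.1‖ ≤ ε / 2 * |z.2| := by
      rcases lt_trichotomy z.2 0 with h0 | h0 | h0
      · have h3 := hv (z.1, -z.2) ⟨hz1.1, by simpa using h0, by
          rw [abs_of_neg h0] at hz2; exact hz2.trans_le (min_le_left _ _)⟩ (by
          rw [abs_of_neg h0] at hz2; exact hz2.trans_le (min_le_right _ _))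
        rw [abs_of_neg h0]
        simp only [oddExtension, h0.not_gt, h0.ne, if_false]
        have e : (2 : ℝ) • g z.1 - s (z.1, -z.2) - g z.1 - z.2 • u z.1 =
            -(s (z.1, -z.2) - g z.1 - (-z.2) • u z.1) := by module
        rw [e, norm_neg]
        exact h3
      · simp [oddExtension, h0]
      · have h3 := hv z ⟨hz1.1, h0, by
          rw [abs_of_pos h0] at hz2; exact hz2.trans_le (min_le_left _ _)⟩ (by
          rw [abs_of_pos h0] at hz2; exact hz2.trans_le (min_le_right _ _))
        rw [abs_of_pos h0]
        simpa only [oddExtension, h0, if_true] using h3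
    have e : oddExtension g s z - g z.1 - (oddExtension g s (a, 0) - g (a, (0 : ℝ)).1) -
        (ContinuousLinearMap.toSpanSingleton ℝ (u a) ∘L ContinuousLinearMap.snd ℝ A ℝ)
          (z - (a, 0)) =
        (oddExtension g s z - g z.1 - z.2 • u z.1) + z.2 • (u z.1 - u a) := by
      have : oddExtension g s (a, 0) = g a := by simp [oddExtension]
      simp only [this, ContinuousLinearMap.comp_apply, ContinuousLinearMap.coe_snd',
        Prod.snd_sub, sub_zero, ContinuousLinearMap.toSpanSingleton_apply]
      module
    rw [e]
    have hz2' : |z.2| ≤ ‖z - (a, 0)‖ := by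
      have := norm_snd_le (z - (a, 0))
      simpa using this
    calc _ ≤ ε / 2 * |z.2| + |z.2| * (ε / 2) := by
          refine (norm_add_le _ _).trans (add_le_add hodd ?_)
          rw [norm_smul, Real.norm_eq_abs]
          gcongr
          exact hz1.2.le
      _ = ε * |z.2| := by ring
      _ ≤ ε * ‖z - (a, 0)‖ := by gcongr
  have h2 := h1.add (hg.hasFDerivAt.comp ((a, 0) : A × ℝ) hasFDerivAt_fst)
  have e1 : (fun z => oddExtension g s z - g z.1) + g ∘ Prod.fst = oddExtension g s := by
    funext z; simp
  have e2 : ContinuousLinearMap.toSpanSingleton ℝ (u a) ∘L ContinuousLinearMap.snd ℝ A ℝ +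
      fderiv ℝ g a ∘L ContinuousLinearMap.fst ℝ A ℝ = edgeDeriv g u a := by
    refine ContinuousLinearMap.ext fun b => ?_
    simp [edgeDeriv_apply, add_comm]
  rw [e1, e2] at h2
  exact h2

/-- Only height `0` is in question. The operation sending the derivative of `s` to that of its
reflection fixes `edgeDeriv`, so the derivatives from both sides approach the same continuous
family, which is also the derivative on the edge. -/
lemma contDiffOn_oddExtension (hS : IsOpen S) (hδ : 0 < δ) (hg : ContDiffOn ℝ 1 g S)
    (hs : ContDiffOn ℝ 1 s (S ×ˢ Ioo 0 δ)) (hu : ContinuousOn u S)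
    (hval : ∀ ε > 0, ∃ δ' > 0, ∀ z ∈ S ×ˢ Ioo 0 δ, z.2 < δ' →
      ‖s z - g z.1 - z.2 • u z.1‖ ≤ ε * z.2)
    (hder : ∀ ε > 0, ∃ δ' > 0, ∀ z ∈ S ×ˢ Ioo 0 δ, z.2 < δ' →
      ‖fderiv ℝ s z - edgeDeriv g u z.1‖ ≤ ε) :
    ContDiffOn ℝ 1 (oddExtension g s) (S ×ˢ Ioo (-δ) δ) := by
  have hOo : IsOpen (S ×ˢ Ioo 0 δ) := hS.prod isOpen_Ioo
  have hOo' : IsOpen (S ×ˢ Ioo (-δ) δ) := hS.prod isOpen_Ioo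
  have hgd : ∀ a ∈ S, DifferentiableAt ℝ g a := fun a ha =>
    (hg.contDiffAt (hS.mem_nhds ha)).differentiableAt one_ne_zero
  have hsd : ∀ z ∈ S ×ˢ Ioo 0 δ, DifferentiableAt ℝ s z := fun z hz =>
    (hs.contDiffAt (hOo.mem_nhds hz)).differentiableAt one_ne_zero
  have hflip : ∀ z ∈ S ×ˢ Ioo (-δ) δ, z.2 < 0 → flipSnd z ∈ S ×ˢ Ioo 0 δ := fun z hz h0 =>
    ⟨hz.1, by simpa using h0, by have := hz.2.1; simp; linarith⟩
  have hzero : ∀ a ∈ S, HasFDerivAt (oddExtension g s) (edgeDeriv g u a) (a, 0) := fun a ha =>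
    hasFDerivAt_oddExtension_of_eq_zero hS hδ hu hval ha (hgd a ha)
  have hdiff : ∀ z ∈ S ×ˢ Ioo (-δ) δ, DifferentiableAt ℝ (oddExtension g s) z := by
    rintro z hz
    rcases lt_trichotomy z.2 0 with h0 | h0 | h0
    · exact (hasFDerivAt_oddExtension_of_neg h0 (hsd _ (hflip z hz h0))
        (hgd _ hz.1)).differentiableAt
    · have := (hzero z.1 hz.1).differentiableAt
      rwa [← h0] at this
    · exact (hasFDerivAt_oddExtension_of_pos h0 (hsd z ⟨hz.1, h0, hz.2.2⟩)).differentiableAt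
  rw [show (1 : WithTop ℕ∞) = 0 + 1 from rfl, contDiffOn_succ_iff_fderiv_of_isOpen hOo']
  refine ⟨fun z hz => (hdiff z hz).differentiableWithinAt, by simp, ?_⟩
  rw [contDiffOn_zero]
  have hcs : ContinuousOn (fderiv ℝ s) (S ×ˢ Ioo 0 δ) :=
    hs.continuousOn_fderiv_of_isOpen hOo le_rfl
  have hcg : ContinuousOn (fderiv ℝ g) S := hg.continuousOn_fderiv_of_isOpen hS le_rfl
  intro z hz
  refine ContinuousAt.continuousWithinAt ?_
  rcases lt_trichotomy z.2 0 with h0 | h0 | h0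
  · have e : ∀ᶠ w in 𝓝 z, fderiv ℝ (oddExtension g s) w =
        (2 : ℝ) • (fderiv ℝ g w.1 ∘L ContinuousLinearMap.fst ℝ A ℝ) -
          fderiv ℝ s (flipSnd w) ∘L flipSnd := by
      filter_upwards [continuous_snd.continuousAt.eventually (gt_mem_nhds h0),
        hOo'.mem_nhds hz] with w hw hwO
      exact (hasFDerivAt_oddExtension_of_neg hw (hsd _ (hflip w hwO hw)) (hgd _ hwO.1)).fderiv
    refine ContinuousAt.congr_of_eventuallyEq ?_ e
    have c1 : ContinuousAt (fun w : A × ℝ => fderiv ℝ g w.1) z :=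
      ContinuousAt.comp (f := Prod.fst) (hcg.continuousAt (hS.mem_nhds hz.1)) continuousAt_fst
    have c2 : ContinuousAt (fun w : A × ℝ => fderiv ℝ s (flipSnd w)) z :=
      ContinuousAt.comp (hcs.continuousAt (hOo.mem_nhds (hflip z hz h0)))
        flipSnd.continuous.continuousAt
    exact ((c1.clm_comp continuousAt_const).const_smul (2 : ℝ)).sub
      (c2.clm_comp continuousAt_const)
  · have hM : ContinuousAt (fun w : A × ℝ => edgeDeriv g u w.1) z := by
      have c1 : ContinuousAt (fun w : A × ℝ => fderiv ℝ g w.1) z :=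
        ContinuousAt.comp (f := Prod.fst) (hcg.continuousAt (hS.mem_nhds hz.1)) continuousAt_fst
      have c2 : ContinuousAt (fun w : A × ℝ => u w.1) z :=
        ContinuousAt.comp (f := Prod.fst) (hu.continuousAt (hS.mem_nhds hz.1)) continuousAt_fst
      have c3 : ContinuousAt (fun w : A × ℝ =>
          ContinuousLinearMap.toSpanSingleton ℝ (u w.1)) z :=
        ContinuousAt.comp (g := fun v : E => ContinuousLinearMap.toSpanSingleton ℝ v)
          (ContinuousLinearMap.toSpanSingletonCLE (𝕜 := ℝ) (E := E)).continuous.continuousAt c2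
      have e : (fun w : A × ℝ => edgeDeriv g u w.1) = fun w : A × ℝ =>
          (fderiv ℝ g w.1) ∘L ContinuousLinearMap.fst ℝ A ℝ +
          ContinuousLinearMap.toSpanSingleton ℝ (u w.1) ∘L ContinuousLinearMap.snd ℝ A ℝ := by
        ext w <;> simp [edgeDeriv]
      rw [e]
      exact (c1.clm_comp continuousAt_const).add (c3.clm_comp continuousAt_const)
    have hE : Tendsto (fun w : A × ℝ => fderiv ℝ (oddExtension g s) w - edgeDeriv g u w.1)
        (𝓝 z) (𝓝 0) := by
      rw [Metric.tendsto_nhds]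
      intro ε hε
      obtain ⟨δ', hδ', hd⟩ := hder (ε / 2) (half_pos hε)
      have e2 : ∀ᶠ w : A × ℝ in 𝓝 z, |w.2| < δ' := by
        have : ContinuousAt (fun z : A × ℝ => |z.2|) z := by fun_prop
        exact this.eventually_lt_const (by simpa [h0] using hδ')
      filter_upwards [e2, hOo'.mem_nhds hz] with w hw hwO
      rw [dist_zero_right]
      refine lt_of_le_of_lt ?_ (half_lt_self hε)
      rcases lt_trichotomy w.2 0 with hw0 | hw0 | hw0
      · rw [(hasFDerivAt_oddExtension_of_neg hw0 (hsd _ (hflip w hwO hw0)) (hgd _ hwO.1)).fderiv]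
        have e3 : (2 : ℝ) • (fderiv ℝ g w.1 ∘L ContinuousLinearMap.fst ℝ A ℝ) -
            fderiv ℝ s (flipSnd w) ∘L flipSnd - edgeDeriv g u w.1 =
            -((fderiv ℝ s (flipSnd w) - edgeDeriv g u w.1) ∘L flipSnd) := by
          refine ContinuousLinearMap.ext fun b => ?_
          simp only [_root_.sub_apply, _root_.smul_apply, _root_.neg_apply,
            ContinuousLinearMap.comp_apply, edgeDeriv_apply, flipSnd_apply,
            ContinuousLinearMap.coe_fst']
          module
        rw [e3, norm_neg]
        refine (ContinuousLinearMap.opNorm_comp_le _ _).trans ?_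
        have h3 := hd (flipSnd w) (hflip w hwO hw0) (by
          rw [abs_of_neg hw0] at hw; simpa using hw)
        refine (mul_le_mul h3 norm_flipSnd_le (norm_nonneg _) (half_pos hε).le).trans ?_
        rw [mul_one]
      · have : w = (w.1, 0) := Prod.ext rfl hw0
        rw [this, (hzero w.1 hwO.1).fderiv]
        simpa using (half_pos hε).le
      · have hwO' : w ∈ S ×ˢ Ioo 0 δ := ⟨hwO.1, hw0, hwO.2.2⟩
        rw [(hasFDerivAt_oddExtension_of_pos hw0 (hsd w hwO')).fderiv]
        exact hd w hwO' (by rwa [abs_of_pos hw0] at hw)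
    have hz0 : fderiv ℝ (oddExtension g s) z = edgeDeriv g u z.1 := by
      have : z = (z.1, 0) := Prod.ext rfl h0
      rw [this, (hzero z.1 hz.1).fderiv]
    have hsum := hE.add hM.tendsto
    simp only [sub_add_cancel, zero_add] at hsum
    rw [ContinuousAt, hz0]
    exact hsum
  · have hzO : z ∈ S ×ˢ Ioo 0 δ := ⟨hz.1, h0, hz.2.2⟩
    refine (hcs.continuousAt (hOo.mem_nhds hzO)).congr_of_eventuallyEq ?_
    filter_upwards [hOo.mem_nhds hzO] with w hw
    exact (hasFDerivAt_oddExtension_of_pos hw.2.1 (hsd w hw)).fderiv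

end Reflection

/-! ### Construction of the charts -/

section Chart

variable {n d : ℕ}

lemma exists_flat_coordinates (hdn : d + 1 ≤ n) :
    ∃ J : EuclideanSpace ℝ (Fin n) ≃L[ℝ] ((Fin d → ℝ) × ℝ) × (Fin (n - (d + 1)) → ℝ),
      (∀ z, z ∈ flat n d ↔ (J z).1.2 = 0 ∧ (J z).2 = 0) ∧
      (∀ z, z ∈ halfFlat n d ↔ 0 ≤ (J z).1.2 ∧ (J z).2 = 0) := by
  set J₀ : EuclideanSpace ℝ (Fin n) →L[ℝ] ((Fin d → ℝ) × ℝ) × (Fin (n - (d + 1)) → ℝ) :=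
    ((ContinuousLinearMap.pi fun i : Fin d => EuclideanSpace.proj (⟨i, by omega⟩ : Fin n)).prod
      (EuclideanSpace.proj (⟨d, by omega⟩ : Fin n))).prod
      (ContinuousLinearMap.pi fun j : Fin (n - (d + 1)) =>
        EuclideanSpace.proj (⟨d + 1 + j, by omega⟩ : Fin n)) with hJ₀
  have h1 : ∀ z (i : Fin d), (J₀ z).1.1 i = z ⟨i, by omega⟩ := fun z i => rfl
  have h2 : ∀ z, (J₀ z).1.2 = z ⟨d, by omega⟩ := fun z => rfl
  have h3 : ∀ z (j : Fin (n - (d + 1))), (J₀ z).2 j = z ⟨d + 1 + j, by omega⟩ := fun z j => rfl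
  have h4 : ∀ z, (J₀ z).2 = 0 ↔ z ∈ flat n (d + 1) := by
    intro z
    constructor
    · intro h i hi
      have := congrFun h ⟨i - (d + 1), by omega⟩
      rw [h3] at this
      have hi' : (⟨d + 1 + (i - (d + 1)), by omega⟩ : Fin n) = i := by ext; simp; omega
      simpa [hi'] using this
    · intro h
      ext j
      rw [h3]
      exact h _ (by simp)
  have hinj : Function.Injective J₀.toLinearMap := by
    rw [injective_iff_map_eq_zero]
    intro z hz
    have hz1 : (J₀ z).1.1 = 0 := congrArg (fun q => q.1.1) hz
    have hz2 : (J₀ z).1.2 = 0 := congrArg (fun q => q.1.2) hz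
    have hz3 : (J₀ z).2 = 0 := congrArg (fun q => q.2) hz
    ext i
    rcases lt_trichotomy (i : ℕ) d with hi | hi | hi
    · exact congrFun hz1 ⟨i, hi⟩
    · rw [h2] at hz2
      have hi' : (⟨d, by omega⟩ : Fin n) = i := by ext; simp [hi]
      rwa [hi'] at hz2
    · exact (h4 z).1 hz3 i hi
  have hbij : Function.Bijective J₀.toLinearMap :=
    ⟨hinj, (LinearMap.injective_iff_surjective_of_finrank_eq_finrank (by simp; omega)).1 hinj⟩
  refine ⟨(LinearEquiv.ofBijective J₀.toLinearMap hbij).toContinuousLinearEquiv, fun z => ?_,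
    fun z => ?_⟩
  · change z ∈ flat n d ↔ (J₀ z).1.2 = 0 ∧ (J₀ z).2 = 0
    rw [h4, h2]
    constructor
    · exact fun h => ⟨h _ le_rfl, fun i hi => h i (by omega)⟩
    · rintro ⟨h5, h6⟩ i hi
      rcases hi.eq_or_lt with hi' | hi'
      · have hid : (⟨d, by omega⟩ : Fin n) = i := by ext; simp [hi']
        rwa [hid] at h5
      · exact h6 i hi'
  · change z ∈ halfFlat n d ↔ 0 ≤ (J₀ z).1.2 ∧ (J₀ z).2 = 0
    rw [h4, h2]
    constructor
    · exact fun h => ⟨h.2 _ rfl, h.1⟩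
    · rintro ⟨h5, h6⟩
      refine ⟨h6, fun i hi => ?_⟩
      have hid : (⟨d, by omega⟩ : Fin n) = i := by ext; simp [hi]
      rwa [hid] at h5

/-- An injective linear map extends to an isomorphism. -/
lemma exists_complement {E B : Type*} [NormedAddCommGroup E] [NormedSpace ℝ E]
    [FiniteDimensional ℝ E] [NormedAddCommGroup B] [NormedSpace ℝ B] [FiniteDimensional ℝ B]
    {m : ℕ} (hm : Module.finrank ℝ B + m = Module.finrank ℝ E) (Λ : B →L[ℝ] E)
    (hΛ : Function.Injective Λ) :
    ∃ (C : (Fin m → ℝ) →L[ℝ] E) (e : (B × (Fin m → ℝ)) ≃L[ℝ] E),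
      (e : B × (Fin m → ℝ) →L[ℝ] E) = Λ.coprod C := by
  obtain ⟨Q, hQ⟩ := Submodule.exists_isCompl Λ.toLinearMap.range
  have hfQ : Module.finrank ℝ Q = m := by
    have h1 := Submodule.finrank_add_eq_of_isCompl hQ
    have h2 : Module.finrank ℝ Λ.toLinearMap.range = Module.finrank ℝ B :=
      LinearMap.finrank_range_of_inj hΛ
    omega
  set f : (Fin m → ℝ) ≃ₗ[ℝ] Q := LinearEquiv.ofFinrankEq _ _ (by simp [hfQ]) with hf
  set C : (Fin m → ℝ) →L[ℝ] E := (Q.subtype ∘ₗ f.toLinearMap).toContinuousLinearMap with hC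
  have hCa : ∀ w, C w = (f w : E) := fun w => rfl
  have hinj : Function.Injective (Λ.coprod C).toLinearMap := by
    rw [injective_iff_map_eq_zero]
    rintro ⟨b, w⟩ h
    have h' : Λ b + (f w : E) = 0 := by simpa [hCa] using h
    have h1 : Λ b ∈ Λ.toLinearMap.range ⊓ Q := by
      refine ⟨⟨b, rfl⟩, ?_⟩
      rw [eq_neg_of_add_eq_zero_left h']
      exact Q.neg_mem (f w).2
    rw [hQ.inf_eq_bot, Submodule.mem_bot] at h1
    have hb : b = 0 := hΛ (by rw [h1, map_zero])
    rw [h1, zero_add] at h'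
    have hw : w = 0 := f.injective (by rw [map_zero]; exact Subtype.ext h')
    rw [hb, hw]; rfl
  have hbij : Function.Bijective (Λ.coprod C).toLinearMap :=
    ⟨hinj, (LinearMap.injective_iff_surjective_of_finrank_eq_finrank (by simp [hm])).1 hinj⟩
  refine ⟨C, (LinearEquiv.ofBijective (Λ.coprod C).toLinearMap hbij).toContinuousLinearEquiv, ?_⟩
  ext <;> rfl

/-- Take for `P` a linear projection onto the tangent space at `x`, read in coordinates; it is
injective on that space. -/
lemma IsSubmanifold.exists_isGraphOn {k : WithTop ℕ∞} (hk : 1 ≤ k)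
    {X : Set (EuclideanSpace ℝ (Fin n))} (hX : IsSubmanifold k d X)
    {x : EuclideanSpace ℝ (Fin n)} (hx : x ∈ X) :
    ∃ (P : EuclideanSpace ℝ (Fin n) →L[ℝ] (Fin d → ℝ)) (g : (Fin d → ℝ) → EuclideanSpace ℝ (Fin n))
      (U : Set (EuclideanSpace ℝ (Fin n))) (W : Set (Fin d → ℝ)),
      x ∈ U ∧ IsGraphOn X P g U W := by
  have hfin := hX.finrank_tangentSpace hk hx
  obtain ⟨f, hf⟩ := LinearMap.exists_leftInverse_of_injective (tangentSpace X x).subtype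
    (Submodule.ker_subtype _)
  set e : tangentSpace X x ≃ₗ[ℝ] (Fin d → ℝ) := LinearEquiv.ofFinrankEq _ _ (by simp [hfin])
  set P : EuclideanSpace ℝ (Fin n) →L[ℝ] (Fin d → ℝ) :=
    (e.toLinearMap ∘ₗ f).toContinuousLinearMap with hP
  obtain ⟨U, W, g, h1, h2, h3, h4, h5, h6⟩ := hX.exists_section hk (F := Fin d → ℝ) (by simp) hx
    P.contDiff.contDiffAt P.hasFDerivAt (by
      intro w hw hPw
      have h1 : e (f w) = 0 := hPw
      have h2 : f w = 0 := e.map_eq_zero_iff.1 h1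
      have h3 : f w = ⟨w, hw⟩ := congrArg (fun l => l (⟨w, hw⟩ : tangentSpace X x)) hf
      rw [h3] at h2
      exact congrArg Subtype.val h2)
  exact ⟨P, g, U, W, h2, h1, h3, h4, h5, h6⟩

variable {L : Language} [L.Structure ℝ] {X Y : Set (EuclideanSpace ℝ (Fin n))}

/-- A chart of the manifold with boundary `X ∪ Y` at a point of `X`. -/
theorem exists_boundary_chart (hL : IsOMinimal L) (hpb : IsPolynomiallyBounded L)
    (hXdef : IsDefinable L X) (hYdef : IsDefinable L Y)
    (hX : IsSubmanifold 2 d X) (hY : IsSubmanifold 2 (d + 1) Y)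
    (hdisj : Disjoint X Y) (hlc : IsLocallyClosed (X ∪ Y))
    (hb : ∀ x ∈ X, WhitneyBAt Y X x) {x : EuclideanSpace ℝ (Fin n)} (hx : x ∈ X)
    (hconn : ConnectedNear Y x) :
    ∃ Φ : OpenPartialHomeomorph (EuclideanSpace ℝ (Fin n)) (EuclideanSpace ℝ (Fin n)),
      x ∈ Φ.source ∧ IsDiffeo 1 Φ ∧ ∀ z ∈ Φ.source,
        (z ∈ X ∪ Y ↔ Φ z ∈ halfFlat n d) ∧ (z ∈ X ↔ Φ z ∈ flat n d) := by
  obtain ⟨P, g, U, W, hxU, h⟩ := hX.exists_isGraphOn one_le_two hx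
  have hxU' : x ∈ X ∩ U := ⟨hx, hxU⟩
  obtain ⟨hxW, hgx⟩ := h.eq_of_mem x hxU'
  obtain ⟨r, hr, δ, hδ, s, hrW, hsd, hs, hsY, hest⟩ :=
    h.exists_section hY hdisj hlc hb hxU' hconn
  obtain ⟨N, t₁, ht₁, r', hr', hr'r, hosc⟩ := h.direction_oscillation_le_pow hL hpb hXdef hYdef
    hxU' hr hδ hrW hsd hs hsY hest
  obtain ⟨u, hu⟩ := exists_uniform_limit (u := fun z => direction P g (s z))
    (S := Metric.ball (P x) r') ht₁ hosc
  set S := Metric.ball (P x) r' with hSdef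
  have hSr : S ⊆ Metric.ball (P x) r := Metric.ball_subset_ball hr'r
  have hSW : S ⊆ W := fun a ha => hrW (Metric.ball_subset_closedBall (hSr ha))
  have hPxS : P x ∈ S := Metric.mem_ball_self hr'
  have hSo : IsOpen S := Metric.isOpen_ball
  have hO : S ×ˢ Ioo 0 δ ⊆ Metric.ball (P x) r ×ˢ Ioo 0 δ := prod_mono hSr subset_rfl
  have hdir : ∀ z ∈ S ×ˢ Ioo 0 δ, direction P g (s z) = z.2⁻¹ • (s z - g z.1) := fun z hz =>
    direction_eq_of_footHeight_eq (hs z (hO hz)).2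
  -- A uniform limit of the continuous maps `a ↦ direction P g (s (a, t))`.
  have hucont : ContinuousOn u S := by
    have hlim : TendstoUniformlyOn (fun t a => direction P g (s (a, t))) u (𝓝[>] (0 : ℝ)) S := by
      rw [Metric.tendstoUniformlyOn_iff]
      intro ε hε
      obtain ⟨δ', hδ', h1⟩ := hu (ε / 2) (half_pos hε)
      filter_upwards [Ioo_mem_nhdsGT hδ'] with t ht a ha
      rw [dist_comm, dist_eq_norm]
      exact (h1 a ha t ht.1 ht.2).trans_lt (half_lt_self hε)
    refine hlim.continuousOn (Eventually.frequently ?_)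
    filter_upwards [Ioo_mem_nhdsGT hδ] with t ht
    have h1 : ContinuousOn (fun a => t⁻¹ • (s (a, t) - g a)) S := by
      have h2 : ContinuousOn (fun a => s (a, t)) S :=
        hsd.continuousOn.comp (by fun_prop) fun a ha => ⟨hSr ha, ht⟩
      exact (h2.sub (h.contDiffOn.continuousOn.mono hSW)).const_smul t⁻¹
    exact h1.congr fun a ha => hdir (a, t) ⟨ha, ht⟩
  have hulim : Tendsto (fun t => direction P g (s (P x, t))) (𝓝[>] (0 : ℝ)) (𝓝 (u (P x))) := by
    rw [Metric.tendsto_nhds]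
    intro ε hε
    obtain ⟨δ', hδ', h1⟩ := hu (ε / 2) (half_pos hε)
    filter_upwards [Ioo_mem_nhdsGT hδ'] with t ht
    rw [dist_eq_norm]
    exact (h1 _ hPxS t ht.1 ht.2).trans_lt (half_lt_self hε)
  have hune : u (P x) ≠ 0 := by
    have h1 : ‖u (P x)‖ = 1 := by
      refine tendsto_nhds_unique hulim.norm (tendsto_const_nhds.congr' ?_)
      filter_upwards [Ioo_mem_nhdsGT hδ] with t ht
      exact (norm_direction_of_footHeight_eq (hs _ ⟨hSr hPxS, ht⟩).2 ht.1).symm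
    intro h0
    rw [h0, norm_zero] at h1
    exact zero_ne_one h1
  have hPu : P (u (P x)) = 0 := by
    refine tendsto_nhds_unique ((P.continuous.tendsto _).comp hulim)
      (tendsto_const_nhds.congr' ?_)
    filter_upwards [Ioo_mem_nhdsGT hδ] with t ht
    have : P (s (P x, t)) = P x := congrArg Prod.fst (hs (P x, t) ⟨hSr hPxS, ht⟩).2
    exact (h.map_direction (by rwa [this])).symm
  have hval : ∀ ε > 0, ∃ δ' > 0, ∀ z ∈ S ×ˢ Ioo 0 δ, z.2 < δ' →
      ‖s z - g z.1 - z.2 • u z.1‖ ≤ ε * z.2 := by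
    intro ε hε
    obtain ⟨δ', hδ', h1⟩ := hu ε hε
    refine ⟨δ', hδ', fun z hz hzδ => ?_⟩
    have h2 := h1 z.1 hz.1 z.2 hz.2.1 hzδ
    have e : s z - g z.1 - z.2 • u z.1 = z.2 • (direction P g (s z) - u z.1) := by
      rw [hdir z hz, smul_sub, smul_smul, mul_inv_cancel₀ hz.2.1.ne', one_smul]
    rw [e, norm_smul, Real.norm_of_nonneg hz.2.1.le, mul_comm]
    have := hz.2.1
    gcongr
  have hder : ∀ ε > 0, ∃ δ' > 0, ∀ z ∈ S ×ˢ Ioo 0 δ, z.2 < δ' →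
      ‖fderiv ℝ s z - edgeDeriv g u z.1‖ ≤ ε := by
    intro ε hε
    obtain ⟨δ₁, hδ₁, h1⟩ := hu (ε / 2) (half_pos hε)
    obtain ⟨δ₂, hδ₂, h2⟩ := hest (ε / 2) (half_pos hε)
    refine ⟨min δ₁ δ₂, lt_min hδ₁ hδ₂, fun z hz hzδ => ?_⟩
    have h3 := h1 z.1 hz.1 z.2 hz.2.1 (hzδ.trans_le (min_le_left _ _))
    have h4 := h2 z (hO hz) (hzδ.trans_le (min_le_right _ _))
    have hPs : P (s z) = z.1 := congrArg Prod.fst (hs z (hO hz)).2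
    have h5 : ‖frame P g (s z) - edgeDeriv g u z.1‖ ≤ ε / 2 := by
      refine ContinuousLinearMap.opNorm_le_bound _ (half_pos hε).le fun b => ?_
      rw [_root_.sub_apply, frame_apply, edgeDeriv_apply, hPs, add_sub_add_left_eq_sub,
        ← smul_sub, norm_smul, mul_comm]
      gcongr
      exact norm_snd_le b
    calc _ ≤ ‖fderiv ℝ s z - frame P g (s z)‖ + ‖frame P g (s z) - edgeDeriv g u z.1‖ :=
          norm_sub_le_norm_sub_add_norm_sub _ _ _
      _ ≤ ε / 2 + ε / 2 := add_le_add h4 h5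
      _ = ε := by ring
  have hext : ContDiffOn ℝ 1 (oddExtension g s) (S ×ˢ Ioo (-δ) δ) :=
    contDiffOn_oddExtension hSo hδ (h.contDiffOn.mono hSW) (hsd.mono hO) hucont hval hder
  have hext0 : HasFDerivAt (oddExtension g s) (edgeDeriv g u (P x)) (P x, 0) :=
    hasFDerivAt_oddExtension_of_eq_zero hSo hδ hucont hval hPxS
      (h.hasFDerivAt hxW).differentiableAt
  have hBo : IsOpen (S ×ˢ Ioo (-δ) δ) := hSo.prod isOpen_Ioo
  have h0B : (P x, (0 : ℝ)) ∈ S ×ˢ Ioo (-δ) δ := ⟨hPxS, by simpa using hδ, hδ⟩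
  -- Applying `P` recovers the first component, as `P` inverts the derivative of `g` and kills `u (P
  -- x)`; the second is recovered because `u (P x)` is a limit of unit vectors and does not vanish.
  have hinj : Function.Injective (edgeDeriv g u (P x)) := by
    rw [injective_iff_map_eq_zero]
    intro b hb
    rw [edgeDeriv_apply] at hb
    have h1 : b.1 = 0 := by
      have := congrArg P hb
      rwa [map_add, h.map_fderiv hxW, map_smul, hPu, smul_zero, add_zero, map_zero] at this
    rw [h1, map_zero, zero_add] at hb
    exact Prod.ext h1 ((smul_eq_zero.1 hb).resolve_right hune)
  have hdn := hY.1
  obtain ⟨C, e, he⟩ := exists_complement (m := n - (d + 1)) (by simp; omega)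
    (edgeDeriv g u (P x)) hinj
  have hΘ : ContDiffAt ℝ 1 (fun q : ((Fin d → ℝ) × ℝ) × (Fin (n - (d + 1)) → ℝ) =>
      oddExtension g s q.1 + C q.2) ((P x, 0), 0) :=
    ((hext.contDiffAt (hBo.mem_nhds h0B)).comp
      (((P x, 0), 0) : ((Fin d → ℝ) × ℝ) × (Fin (n - (d + 1)) → ℝ)) contDiffAt_fst).add
      (C.contDiff.contDiffAt.comp _ contDiffAt_snd)
  have hΘ' : HasFDerivAt (fun q : ((Fin d → ℝ) × ℝ) × (Fin (n - (d + 1)) → ℝ) =>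
      oddExtension g s q.1 + C q.2) (e : _ →L[ℝ] EuclideanSpace ℝ (Fin n)) ((P x, 0), 0) := by
    have h1 := (hext0.comp (((P x, 0), 0) : ((Fin d → ℝ) × ℝ) × (Fin (n - (d + 1)) → ℝ))
      hasFDerivAt_fst).add (C.hasFDerivAt.comp
        (((P x, 0), 0) : ((Fin d → ℝ) × ℝ) × (Fin (n - (d + 1)) → ℝ)) hasFDerivAt_snd)
    have h2 : edgeDeriv g u (P x) ∘L ContinuousLinearMap.fst ℝ _ _ +
        C ∘L ContinuousLinearMap.snd ℝ _ _ = (e : _ →L[ℝ] EuclideanSpace ℝ (Fin n)) := by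
      rw [he]
      refine ContinuousLinearMap.ext fun b => ?_
      simp
    rw [h2] at h1
    exact h1
  obtain ⟨φ, hφ0, hφ, hφc, hφs⟩ := exists_openPartialHomeomorph_contDiffOn hΘ hΘ'
  obtain ⟨J, hJ, hJ'⟩ := exists_flat_coordinates hdn
  have hφa : ∀ q, φ q = oddExtension g s q.1 + C q.2 := fun q => congrFun hφ q
  have hg0 : ∀ a, oddExtension g s (a, 0) = g a := fun a => by simp [oddExtension]
  have hpos : ∀ z : (Fin d → ℝ) × ℝ, 0 < z.2 → oddExtension g s z = s z := fun z hz => by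
    simp [oddExtension, hz]
  have hφx : φ ((P x, 0), 0) = x := by rw [hφa]; simp [hg0, hgx]
  have hxt : x ∈ φ.target := by rw [← hφx]; exact φ.map_source hφ0
  have hφsx : φ.symm x = ((P x, 0), 0) := by
    have := φ.left_inv hφ0
    rwa [hφx] at this
  have hgP : ContinuousAt (fun y => g (P y)) x :=
    ContinuousAt.comp (h.contDiffAt hxW).continuousAt P.continuous.continuousAt
  -- For `y` near `x`, the expected preimages `((P y, 0), 0)` of a point of `X` and `(footHeight P g
  -- y, 0)` of a point of `Y` lie in the source of `φ`. Injectivity of `φ` there forces `φ.symm y`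
  -- to be the expected one.
  have hev : ∀ᶠ y in 𝓝 x, y ∈ U ∧ (y ∈ Y → s (footHeight P g y) = y) ∧
      (((P y, 0), 0) : ((Fin d → ℝ) × ℝ) × (Fin (n - (d + 1)) → ℝ)) ∈ φ.source ∧
      ((footHeight P g y, 0) : ((Fin d → ℝ) × ℝ) × (Fin (n - (d + 1)) → ℝ)) ∈ φ.source ∧
      (φ.symm y).1 ∈ S ×ˢ Ioo (-δ) δ ∧ P y ∈ W := by
    have c1 : ContinuousAt (fun y =>
        (((P y, 0), 0) : ((Fin d → ℝ) × ℝ) × (Fin (n - (d + 1)) → ℝ))) x := by fun_prop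
    have c2 : ContinuousAt (fun y =>
        ((footHeight P g y, 0) : ((Fin d → ℝ) × ℝ) × (Fin (n - (d + 1)) → ℝ))) x :=
      (P.continuous.continuousAt.prodMk (continuousAt_id.sub hgP).norm).prodMk continuousAt_const
    have c3 : ContinuousAt (fun y => (φ.symm y).1) x :=
      ContinuousAt.fst (φ.symm.continuousAt hxt)
    have hf0 : footHeight P g x = (P x, 0) := by simp [footHeight, hgx]
    refine (h.isOpen_source.eventually_mem hxU).and (hsY.and
      ((c1.eventually_mem (φ.open_source.mem_nhds hφ0)).and
      ((c2.eventually_mem (φ.open_source.mem_nhds (by rw [hf0]; exact hφ0))).and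
      ((c3.eventually_mem (hBo.mem_nhds (by rw [hφsx]; exact h0B))).and ?_))))
    exact P.continuous.continuousAt.eventually_mem (h.isOpen_base.mem_nhds hxW)
  obtain ⟨V, hV, hVo, hxV⟩ := eventually_nhds_iff.1 hev
  set ψ := φ.symm.restrOpen V hVo with hψ
  have hψt : ψ.target ⊆ φ.source := fun q hq => by
    have h1 := ψ.map_target hq
    have h2 : φ.symm (φ q) = q := ψ.right_inv hq
    rw [← h2]
    exact φ.map_target h1.1
  refine ⟨ψ.transHomeomorph J.symm.toHomeomorph, ⟨hxt, hxV⟩, ⟨?_, ?_⟩, ?_⟩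
  · exact J.symm.contDiff.comp_contDiffOn (hφs.mono inter_subset_left)
  · exact (hφc.mono hψt).comp J.contDiff.contDiffOn fun z hz => hz
  · rintro y ⟨hyt, hyV⟩
    obtain ⟨hyU, hyY, hy1, hy2, hyB, hyW⟩ := hV y hyV
    have hΦ : ∀ (y : EuclideanSpace ℝ (Fin n)),
        J ((ψ.transHomeomorph J.symm.toHomeomorph) y) = φ.symm y := fun y =>
      J.apply_symm_apply _
    rw [hJ, hJ', hΦ]
    have hφy : oddExtension g s (φ.symm y).1 + C (φ.symm y).2 = y := by
      rw [← hφa]; exact φ.right_inv hyt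
    have hXmp : y ∈ X → φ.symm y = ((P y, 0), 0) := by
      intro hyX
      have h1 : φ ((P y, 0), 0) = y := by
        rw [hφa]; simp [hg0, (h.eq_of_mem y ⟨hyX, hyU⟩).2]
      have := φ.left_inv hy1
      rwa [h1] at this
    have hYmp : y ∈ Y → φ.symm y = (footHeight P g y, 0) ∧ 0 < (footHeight P g y).2 := by
      intro hyY'
      have hp : 0 < (footHeight P g y).2 := by
        refine norm_pos_iff.2 (sub_ne_zero.2 fun e => ?_)
        exact Set.disjoint_left.1 hdisj (h.mem_of_mem_base _ hyW).1.1 (e ▸ hyY')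
      have h1 : φ (footHeight P g y, 0) = y := by
        rw [hφa]; simp [hpos _ hp, hyY hyY']
      have := φ.left_inv hy2
      rw [h1] at this
      exact ⟨this, hp⟩
    have hXmpr : (φ.symm y).1.2 = 0 → (φ.symm y).2 = 0 → y ∈ X := by
      intro h1 h2
      have h3 : (φ.symm y).1 = ((φ.symm y).1.1, 0) := Prod.ext rfl h1
      rw [h2, map_zero, add_zero, h3, hg0] at hφy
      rw [← hφy]
      exact (h.mem_of_mem_base _ (hSW hyB.1)).1.1
    have hYmpr : 0 < (φ.symm y).1.2 → (φ.symm y).2 = 0 → y ∈ Y := by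
      intro h1 h2
      rw [h2, map_zero, add_zero, hpos _ h1] at hφy
      rw [← hφy]
      exact (hs _ (hO ⟨hyB.1, h1, hyB.2.2⟩)).1
    refine ⟨⟨?_, ?_⟩, ⟨?_, ?_⟩⟩
    · rintro (hyX | hyY')
      · rw [hXmp hyX]; exact ⟨le_rfl, rfl⟩
      · rw [(hYmp hyY').1]; exact ⟨(hYmp hyY').2.le, rfl⟩
    · rintro ⟨h1, h2⟩
      rcases h1.eq_or_lt with h1 | h1
      · exact Or.inl (hXmpr h1.symm h2)
      · exact Or.inr (hYmpr h1 h2)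
    · intro hyX
      rw [hXmp hyX]; exact ⟨rfl, rfl⟩
    · rintro ⟨h1, h2⟩
      exact hXmpr h1 h2

/-- A chart of `X ∪ Y` at a point of `Y`. -/
lemma IsSubmanifold.exists_interior_chart (hY : IsSubmanifold 2 (d + 1) Y)
    (hdisj : Disjoint X Y) (hXY : X ⊆ closure Y) {p : EuclideanSpace ℝ (Fin n)} (hp : p ∈ Y) :
    ∃ Φ : OpenPartialHomeomorph (EuclideanSpace ℝ (Fin n)) (EuclideanSpace ℝ (Fin n)),
      p ∈ Φ.source ∧ IsDiffeo 1 Φ ∧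
      ∀ x ∈ Φ.source, (x ∈ X ∪ Y ↔ Φ x ∈ flat n (d + 1)) ∧ x ∉ X := by
  obtain ⟨Φ, hpΦ, hΦ, hM⟩ := hY.2 p hp
  have hclosed : IsClosed (flat n (d + 1)) := by
    have : flat n (d + 1) = ⋂ i : Fin n, ⋂ _ : d + 1 ≤ (i : ℕ),
        {z : EuclideanSpace ℝ (Fin n) | z i = 0} := by
      ext z; simp [flat]
    rw [this]
    exact isClosed_iInter fun i => isClosed_iInter fun _ =>
      isClosed_eq (by fun_prop) continuous_const
  -- A point of `X` in the source is a limit of points of `Y`. As `flat n (d + 1)` is closed it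
  -- would be sent there, hence belong to `Y`.
  have hX : ∀ x ∈ Φ.source, x ∉ X := by
    intro x hx hxX
    refine Set.disjoint_left.1 hdisj hxX ((hM x hx).2 ?_)
    by_contra hnot
    have hopen : IsOpen (Φ.source ∩ Φ ⁻¹' (flat n (d + 1))ᶜ) :=
      Φ.isOpen_inter_preimage hclosed.isOpen_compl
    obtain ⟨y, ⟨hy1, hy2⟩, hyY⟩ := mem_closure_iff.1 (hXY hxX) _ hopen ⟨hx, hnot⟩
    exact hy2 ((hM y hy1).1 hyY)
  refine ⟨Φ, hpΦ, ⟨hΦ.1.of_le one_le_two, hΦ.2.of_le one_le_two⟩, fun x hx => ⟨?_, hX x hx⟩⟩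
  rw [← hM x hx]
  exact ⟨fun h => h.resolve_left (hX x hx), Or.inr⟩

end Chart

end WhitneyPawlucki
end

/-! ### Assembly of the charts -/

open WhitneyPawlucki in
theorem corollary3p11 (L : FirstOrder.Language) [L.Structure ℝ]
    (hL : IsOMinimal L) (hpb : IsPolynomiallyBounded L)
    {n d : ℕ} (X Y : Set (EuclideanSpace ℝ (Fin n)))
    (hXdef : IsDefinable L X) (hYdef : IsDefinable L Y)
    (hX : IsSubmanifold 2 d X) (hY : IsSubmanifold 2 (d + 1) Y)
    (hdisj : Disjoint X Y) (hXY : X ⊆ closure Y) (hlc : IsLocallyClosed (X ∪ Y))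
    (hb : ∀ x ∈ X, WhitneyBAt Y X x) :
    (∀ x ∈ X, ConnectedNear Y x →
      ∃ U : Set (EuclideanSpace ℝ (Fin n)), IsOpen U ∧ x ∈ U ∧
        IsSubmanifoldWithBoundary 1 d ((X ∪ Y) ∩ U) (X ∩ U)) ∧
    ((∀ x ∈ X, ConnectedNear Y x) → IsSubmanifoldWithBoundary 1 d (X ∪ Y) X) := by
  refine ⟨fun x hx hconn => ?_, fun hconn => ⟨hY.1, subset_union_left, ?_, ?_⟩⟩
  · obtain ⟨Φ, hxΦ, hΦ, hΦX⟩ :=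
      exists_boundary_chart hL hpb hXdef hYdef hX hY hdisj hlc hb hx hconn
    -- The domain of one boundary chart serves as `U`: the same chart works at every point of `X ∩
    -- U`, and interior charts are restricted to `U`.
    refine ⟨Φ.source, Φ.open_source, hxΦ, hY.1, inter_subset_inter_left _ subset_union_left, ?_, ?_⟩
    · rintro p ⟨⟨hp, hpU⟩, hpX⟩
      have hpY : p ∈ Y := hp.resolve_left fun h => hpX ⟨h, hpU⟩
      obtain ⟨Ψ, hpΨ, hΨ, hΨY⟩ := hY.exists_interior_chart hdisj hXY hpY
      have hsub : (Ψ.restrOpen Φ.source Φ.open_source).target ⊆ Ψ.target := fun q hq => by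
        have h1 := (Ψ.restrOpen Φ.source Φ.open_source).map_target hq
        have h2 : Ψ (Ψ.symm q) = q := (Ψ.restrOpen Φ.source Φ.open_source).right_inv hq
        rw [← h2]
        exact Ψ.map_source h1.1
      refine ⟨Ψ.restrOpen Φ.source Φ.open_source, ⟨hpΨ, hpU⟩,
        ⟨hΨ.1.mono inter_subset_left, hΨ.2.mono hsub⟩, ?_⟩
      rintro y ⟨hy, hyU⟩
      refine ⟨?_, fun h => (hΨY y hy).2 h.1⟩
      exact ⟨fun h => (hΨY y hy).1.1 h.1, fun h => ⟨(hΨY y hy).1.2 h, hyU⟩⟩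
    · rintro p ⟨hp, hpU⟩
      refine ⟨Φ, hpU, hΦ, fun z hz => ?_⟩
      simpa [hz] using hΦX z hz
  · rintro p ⟨hp, hpX⟩
    exact hY.exists_interior_chart hdisj hXY (hp.resolve_left hpX)
  · intro p hp
    exact exists_boundary_chart hL hpb hXdef hYdef hX hY hdisj hlc hb hp (hconn p hp)
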